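/- Let $R$ be a commutative ring with identity and let $\mathcal Z$ be a non-empty class of finite groups closed under subquotients and direct products. Let $\Omega_{R,\mathcal Z}$ be the biset category: its objects are the groups in $\mathcal Z$, and $\mathrm{Hom}(G,H)=RB(H,G)$ is $R\otimes_{\mathbb Z}$ the Grothendieck group of finite $(H,G)$-bisets, with composition induced by $(V,U)\mapsto V\times_H U$. A biset functor is an $R$-linear functor $\Omega_{R,\mathcal Z}\to R\text{-Mod}$. For a group isomorphism $\varphi:H\to G$, $\mathrm{Iso}(\varphi)$ is the $(G,H)$-biset $G$ on which $G$ acts by left multiplication and $H$ by right multiplication through $\varphi$. A Green biset functor is a biset functor $A$ with $R$-bilinear products $A(G)\times A(H)\to A(G\times H)$, $(a,b)\mapsto a\times b$, for $G,H\in\mathcal Z$, and an element $\varepsilon_A\in A(1)$, such that the products are associative and unital with respect to $\varepsilon_A$ (up to the canonical isomorphisms $G\times(H\times K)\to(G\times H)\times K$, $1\times G\to G$, $G\times 1\to G$), and $A(\alpha\times\beta)(a\times b)=A(\alpha)(a)\times A(\beta)(b)$ for all morphisms $\alpha,\beta$ of $\Omega_{R,\mathcal Z}$. An $A$-module is a biset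 functor $M$ with $R$-bilinear products $A(G)\times M(H)\to M(G\times H)$ that are associative, unital (on the left) and functorial in the same sense. It is simple if it is nonzero and its only $A$-submodules are $0$ and itself. An isomorphism of $A$-modules is an isomorphism of biset functors compatible with the products. A group $H\in\mathcal Z$ is minimal for $M$ if $M(H)\neq0$ and $M(K)=0$ for all $K\in\mathcal Z$ with $|K|<|H|$. Let $\overleftarrow{G}$ be the $(1,G\times G)$-biset $G$ with $x\cdot(g_1,g_2)=g_1^{-1}xg_2$. For $\beta\in A(H\times G)$ and $\alpha\in A(G\times K)$ put $\beta\circ\alpha=A(H\times\overleftarrow{G}\times K)(\beta\times\alpha)\in A(H\times K)$. For an $A$-module $M$, $\alpha\in A(G\times H)$ and $m\in M(H)$ put $\alpha\cdot m=M(G\times\overleftarrow{H})(\alpha\times m)\in M(G)$. For an $(H,G)$-biset $X$ let $\overrightarrow{X}$ be the $(H\times G,1)$-biset $X$ with $(h,g)x=hxg^{-1}$. Then $A(H\times H)$ is an $R$-algebra under $\circ$ with identity $A(\overrightarrow{H})(\varepsilon_A)$. Let $I_A(H)$ be the $R$-submodule of $A(H\times H)$ generated by all $a\circ b$ with $a\in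 A(H\times K)$, $b\in A(K\times H)$, $K\in\mathcal Z$ and $|K|<|H|$; it is a two-sided ideal. Let $\hat A(H)=A(H\times H)/I_A(H)$. For a group isomorphism $\varphi:H\to G$ and an $A(G\times G)$-module $W$, let ${}^{\varphi}W$ be the $A(H\times H)$-module $W$ with action $a\cdot w=(\alpha_1\circ a\circ\alpha_2)w$, where $\alpha_1=A(\overrightarrow{\mathrm{Iso}(\varphi)})(\varepsilon_A)\in A(G\times H)$ and $\alpha_2=A(\overrightarrow{\mathrm{Iso}(\varphi^{-1})})(\varepsilon_A)\in A(H\times G)$. Let $\mathcal S_A$ be the set of equivalence classes of couples $(H,V)$, where $H\in\mathcal Z$, $\hat A(H)\neq0$ and $V$ is a simple $\hat A(H)$-module, with $(H,V)\sim(G,W)$ if there is a group isomorphism $\varphi:H\to G$ such that $V\cong{}^{\varphi}W$ as $A(H\times H)$-modules. **Proposition.** Let $A$ be a Green biset functor such that, for every simple $A$-module, all its minimal groups are isomorphic. Then there is a bijection between the isomorphism classes of simple $A$-modules and $\mathcal S_A$, under which the class of a simple $A$-module $S$ corresponds to the class of a couple $(H,V)$ if and only if $H$ is minimal for $S$ and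 $V\cong S(H)$ as $A(H\times H)$-modules. -/

import Mathlib

universe u r w

/-- A finite `(H, G)`-biset: a finite set with a left action of `H` and a right action of `G`
which commute. -/
structure Biset (H G : Type u) [Group H] [Group G] : Type (u + 1) where
  X : Type u
  finite : Finite X
  /-- the left action `h · x` -/
  l : H → X → X
  /-- the right action `x · g` -/
  r : X → G → X
  one_l : ∀ x, l 1 x = x
  mul_l : ∀ h h' x, l (h * h') x = l h (l h' x)
  r_one : ∀ x, r x 1 = x
  r_mul : ∀ x g g', r x (g * g') = r (r x g) g'
  l_r : ∀ h x g, r (l h x) g = l h (r x g)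

namespace Biset

variable {L K H G H' G' : Type u} [Group L] [Group K] [Group H] [Group G] [Group H'] [Group G']

/-- Two bisets are isomorphic if there is a bijection commuting with both actions. -/
def IsIso (U V : Biset H G) : Prop :=
  ∃ e : U.X ≃ V.X, (∀ h x, e (U.l h x) = V.l h (e x)) ∧ ∀ x g, e (U.r x g) = V.r (e x) g

theorem IsIso.refl (U : Biset H G) : IsIso U U := ⟨Equiv.refl _, fun _ _ => rfl, fun _ _ => rfl⟩

theorem IsIso.symm {U V : Biset H G} : IsIso U V → IsIso V U := by
  rintro ⟨e, hl, hr⟩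
  refine ⟨e.symm, fun h x => ?_, fun x g => ?_⟩
  · rw [Equiv.symm_apply_eq, hl, Equiv.apply_symm_apply]
  · rw [Equiv.symm_apply_eq, hr, Equiv.apply_symm_apply]

theorem IsIso.trans {U V W : Biset H G} : IsIso U V → IsIso V W → IsIso U W := by
  rintro ⟨e, hl, hr⟩ ⟨f, hl', hr'⟩
  exact ⟨e.trans f, fun h x => by simp [hl, hl'], fun x g => by simp [hr, hr']⟩

instance isoSetoid (H G : Type u) [Group H] [Group G] : Setoid (Biset H G) where
  r := IsIso
  iseqv := ⟨IsIso.refl, IsIso.symm, IsIso.trans⟩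

/-- The disjoint union of two bisets. -/
def sum (U V : Biset H G) : Biset H G where
  X := U.X ⊕ V.X
  finite := by have := U.finite; have := V.finite; infer_instance
  l h := Sum.map (U.l h) (V.l h)
  r x g := Sum.map (U.r · g) (V.r · g) x
  one_l := by rintro (x | x) <;> simp [one_l]
  mul_l := by rintro _ _ (x | x) <;> simp [mul_l]
  r_one := by rintro (x | x) <;> simp [r_one]
  r_mul := by rintro (x | x) <;> simp [r_mul]
  l_r := by rintro _ (x | x) <;> simp [l_r]

/-- The empty biset. -/
def empty (H G : Type u) [Group H] [Group G] : Biset H G where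
  X := PEmpty
  finite := inferInstance
  l _ x := x
  r x _ := x
  one_l _ := rfl
  mul_l _ _ _ := rfl
  r_one _ := rfl
  r_mul _ _ _ := rfl
  l_r _ _ _ := rfl

/-- The `H`-orbits on `V × U` for the action `(v, u) · h = (v · h, h⁻¹ · u)`. -/
def compSetoid (V : Biset K H) (U : Biset H G) : Setoid (V.X × U.X) where
  r p q := ∃ h : H, q = (V.r p.1 h, U.l h⁻¹ p.2)
  iseqv := by
    refine ⟨fun p => ⟨1, by simp [r_one, one_l]⟩, ?_, ?_⟩
    · rintro p q ⟨h, rfl⟩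
      exact ⟨h⁻¹, by simp [← r_mul, ← mul_l, r_one, one_l]⟩
    · rintro p q s ⟨h, rfl⟩ ⟨h', rfl⟩
      exact ⟨h * h', by simp [r_mul, mul_l]⟩

/-- The composition `V ×_H U` of a `(K, H)`-biset and an `(H, G)`-biset. -/
def comp (V : Biset K H) (U : Biset H G) : Biset K G where
  X := Quotient (compSetoid V U)
  finite := by have := U.finite; have := V.finite; infer_instance
  l k := Quotient.map (fun p => (V.l k p.1, p.2)) (by
    rintro p q ⟨h, rfl⟩
    exact ⟨h, by simp [l_r]⟩)
  r x g := Quotient.map (fun p => (p.1, U.r p.2 g)) (by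
    rintro p q ⟨h, rfl⟩
    exact ⟨h, by simp [l_r]⟩) x
  one_l := by rintro ⟨p⟩; exact congrArg (Quotient.mk _) (by simp [one_l])
  mul_l := by rintro k k' ⟨p⟩; exact congrArg (Quotient.mk _) (by simp [mul_l])
  r_one := by rintro ⟨p⟩; exact congrArg (Quotient.mk _) (by simp [r_one])
  r_mul := by rintro ⟨p⟩ g g'; exact congrArg (Quotient.mk _) (by simp [r_mul])
  l_r := by rintro k ⟨p⟩ g; rfl

/-- The class of `(v, u)` in `V ×_H U`. -/
def pair {V : Biset K H} {U : Biset H G} (v : V.X) (u : U.X) : (comp V U).X :=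
  Quotient.mk (compSetoid V U) (v, u)

theorem pair_r {V : Biset K H} {U : Biset H G} (v : V.X) (h : H) (u : U.X) :
    (pair (V.r v h) u : (comp V U).X) = pair v (U.l h u) :=
  (Quotient.sound ⟨h, by simp [← mul_l, one_l]⟩ : pair v (U.l h u) = pair (V.r v h) u).symm

theorem pair_inj {V : Biset K H} {U : Biset H G} {v v' : V.X} {u u' : U.X}
    (e : (pair v u : (comp V U).X) = pair v' u') : ∃ h, v' = V.r v h ∧ u' = U.l h⁻¹ u := by
  obtain ⟨h, hh⟩ := Quotient.exact e
  exact ⟨h, (Prod.ext_iff.1 hh).1, (Prod.ext_iff.1 hh).2⟩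

/-- The cartesian product `U × V` as an `(H × H', G × G')`-biset. -/
def prod (U : Biset H G) (V : Biset H' G') : Biset (H × H') (G × G') where
  X := U.X × V.X
  finite := by have := U.finite; have := V.finite; infer_instance
  l h x := (U.l h.1 x.1, V.l h.2 x.2)
  r x g := (U.r x.1 g.1, V.r x.2 g.2)
  one_l := by simp [one_l]
  mul_l := by simp [mul_l]
  r_one := by simp [r_one]
  r_mul := by simp [r_mul]
  l_r := by simp [l_r]

/-- For a group isomorphism `φ : H → G` with `H` finite, the `(G, H)`-biset `Iso(φ)`: the set `G`
with `G` acting by left multiplication and `H` by right multiplication through `φ`. -/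
def iso [Finite H] (φ : H ≃* G) : Biset G H where
  X := G
  finite := Finite.of_equiv H φ.toEquiv
  l g x := g * x
  r x h := x * φ h
  one_l := by simp
  mul_l := by simp [mul_assoc]
  r_one := by simp
  r_mul := by simp [mul_assoc]
  l_r := by simp [mul_assoc]

/-- The `(G, G)`-biset `G`. -/
def refl (G : Type u) [Group G] [Finite G] : Biset G G where
  X := G
  finite := inferInstance
  l g x := g * x
  r x g := x * g
  one_l := by simp
  mul_l := by simp [mul_assoc]
  r_one := by simp
  r_mul := by simp [mul_assoc]
  l_r := by simp [mul_assoc]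

/-- An `(H, G)`-biset `U` seen as an `(H × G, 1)`-biset through `(h, g) x = h x g⁻¹`. -/
def toLeft (U : Biset H G) : Biset (H × G) PUnit.{u + 1} where
  X := U.X
  finite := U.finite
  l p x := U.r (U.l p.1 x) p.2⁻¹
  r x _ := x
  one_l := by simp [r_one, one_l]
  mul_l := by simp [r_mul, mul_l, l_r]
  r_one _ := rfl
  r_mul _ _ _ := rfl
  l_r _ _ _ := rfl

/-- The biset `H × G⃖ × K`, where `G⃖` is the opposite of the `(G × G, 1)`-biset `toLeft (refl G)`,
i.e. the `(1, G × G)`-biset `G` with `x · (g₁, g₂) = g₁⁻¹ x g₂`, seen as an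
`(H × K, (H × G) × (G × K))`-biset. -/
def slit (H G K : Type u) [Group H] [Group G] [Group K] [Finite H] [Finite G] [Finite K] :
    Biset (H × K) ((H × G) × (G × K)) where
  X := H × G × K
  finite := inferInstance
  l p x := (p.1 * x.1, x.2.1, p.2 * x.2.2)
  r x q := (x.1 * q.1.1, q.1.2⁻¹ * x.2.1 * q.2.1, x.2.2 * q.2.2)
  one_l := by simp
  mul_l := by simp [mul_assoc]
  r_one := by simp
  r_mul := by simp [mul_assoc]
  l_r := by simp [mul_assoc]

/-- The biset `G × H⃖`, seen as a `(G, (G × H) × H)`-biset. -/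
def slitAct (G H : Type u) [Group G] [Group H] [Finite G] [Finite H] :
    Biset G ((G × H) × H) where
  X := G × H
  finite := inferInstance
  l g x := (g * x.1, x.2)
  r x q := (x.1 * q.1.1, q.1.2⁻¹ * x.2 * q.2)
  one_l := by simp
  mul_l := by simp [mul_assoc]
  r_one := by simp
  r_mul := by simp [mul_assoc]
  l_r := by simp [mul_assoc]

/-- Recognition of a composition. -/
theorem comp_isIso {V : Biset K H} {U : Biset H G} {W : Biset K G} (f : V.X → U.X → W.X)
    (hf : ∀ v h u, f (V.r v h) u = f v (U.l h u))
    (hl : ∀ k v u, f (V.l k v) u = W.l k (f v u))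
    (hr : ∀ v u g, f v (U.r u g) = W.r (f v u) g)
    (inj : ∀ v u v' u', f v u = f v' u' → ∃ h, v' = V.r v h ∧ u' = U.l h⁻¹ u)
    (surj : ∀ x, ∃ v u, f v u = x) : IsIso (comp V U) W := by
  have key : ∀ p q : V.X × U.X, (compSetoid V U) p q → f p.1 p.2 = f q.1 q.2 := by
    rintro p q ⟨h, rfl⟩
    simp [hf, ← mul_l, one_l]
  refine ⟨Equiv.ofBijective (Quotient.lift (fun p : V.X × U.X => f p.1 p.2) key) ⟨?_, ?_⟩, ?_, ?_⟩
  · rintro ⟨p⟩ ⟨q⟩ e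
    obtain ⟨h, h1, h2⟩ := inj _ _ _ _ e
    exact Quotient.sound ⟨h, Prod.ext h1 h2⟩
  · intro x
    obtain ⟨v, u, rfl⟩ := surj x
    exact ⟨Quotient.mk _ (v, u), rfl⟩
  · rintro k ⟨p⟩; exact hl _ _ _
  · rintro ⟨p⟩ g; exact hr _ _ _

theorem comp_congr {V V' : Biset K H} {U U' : Biset H G} :
    IsIso V V' → IsIso U U' → IsIso (comp V U) (comp V' U') := by
  rintro ⟨e, el, er⟩ ⟨f, fl, fr⟩
  refine comp_isIso (W := comp V' U') (fun v u => pair (e v) (f u)) ?_ ?_ ?_ ?_ ?_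
  · intro v h u
    rw [er, fl, pair_r]
  · intro k v u
    rw [el]; rfl
  · intro v u g
    rw [fr]; rfl
  · intro v u v' u' h
    obtain ⟨h, h1, h2⟩ := pair_inj h
    exact ⟨h, e.injective (by rw [h1, er]), f.injective (by rw [h2, fl])⟩
  · rintro ⟨v, u⟩
    exact ⟨e.symm v, f.symm u, congrArg (Quotient.mk _) (by simp)⟩

theorem comp_assoc (W : Biset L K) (V : Biset K H) (U : Biset H G) :
    IsIso (comp (comp W V) U) (comp W (comp V U)) := by
  refine comp_isIso (W := comp W (comp V U))
    (fun x u => Quotient.liftOn x (fun p => pair p.1 (pair p.2 u)) ?_)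
    ?_ ?_ ?_ ?_ ?_
  · rintro p q ⟨k, rfl⟩
    exact Quotient.sound ⟨k, rfl⟩
  · rintro ⟨w, v⟩ h u
    exact congrArg (pair w) (pair_r v h u)
  · rintro l ⟨w, v⟩ u; rfl
  · rintro ⟨w, v⟩ u g; rfl
  · rintro ⟨w, v⟩ u ⟨w', v'⟩ u' e
    obtain ⟨k, hw, hk⟩ := pair_inj (V := W) (U := comp V U) e
    obtain ⟨h, hv, hu⟩ := pair_inj (V := V) (U := U) (v := V.l k⁻¹ v) (u := u) hk.symm
    subst hw hv hu
    refine ⟨h, ?_, rfl⟩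
    refine Quotient.sound ⟨k⁻¹, ?_⟩
    simp [← r_mul, r_one, l_r, ← mul_l, one_l]
  · rintro ⟨w, ⟨v, u⟩⟩
    exact ⟨pair w v, u, rfl⟩

theorem refl_comp [Finite H] (U : Biset H G) : IsIso (comp (refl H) U) U := by
  refine comp_isIso (fun (h : H) u => U.l h u) ?_ ?_ ?_ ?_ ?_
  · intro v h u; exact U.mul_l _ _ _
  · intro v h u; exact U.mul_l _ _ _
  · intro v u g; exact (U.l_r _ _ _).symm
  · intro (v : H) u (v' : H) u' h
    refine ⟨v⁻¹ * v', by simp [refl], ?_⟩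
    change U.l v u = U.l v' u' at h
    rw [mul_inv_rev, inv_inv, mul_l, h, ← mul_l]
    simp [one_l]
  · intro x; exact ⟨(1 : H), x, U.one_l _⟩

theorem comp_refl [Finite G] (U : Biset H G) : IsIso (comp U (refl G)) U := by
  refine comp_isIso (fun u (g : G) => U.r u g) ?_ ?_ ?_ ?_ ?_
  · intro v h u; exact (U.r_mul _ _ _).symm
  · intro k v u; exact U.l_r _ _ _
  · intro v u g; exact U.r_mul _ _ _
  · intro v (u : G) v' (u' : G) h
    refine ⟨u * u'⁻¹, ?_, by simp [refl]⟩
    change U.r v u = U.r v' u' at h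
    rw [r_mul, h, ← r_mul]
    simp [r_one]
  · intro x; exact ⟨x, (1 : G), U.r_one _⟩

theorem sum_congr {U U' V V' : Biset H G} :
    IsIso U U' → IsIso V V' → IsIso (sum U V) (sum U' V') := by
  rintro ⟨e, el, er⟩ ⟨f, fl, fr⟩
  refine ⟨Equiv.sumCongr e f, ?_, ?_⟩
  · rintro h (x | x)
    · exact congrArg Sum.inl (el h x)
    · exact congrArg Sum.inr (fl h x)
  · rintro (x | x) g
    · exact congrArg Sum.inl (er x g)
    · exact congrArg Sum.inr (fr x g)

theorem sum_assoc (U V W : Biset H G) : IsIso (sum (sum U V) W) (sum U (sum V W)) := by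
  refine ⟨Equiv.sumAssoc _ _ _, ?_, ?_⟩
  · rintro h ((x | x) | x) <;> rfl
  · rintro ((x | x) | x) g <;> rfl

theorem sum_comm (U V : Biset H G) : IsIso (sum U V) (sum V U) := by
  refine ⟨Equiv.sumComm _ _, ?_, ?_⟩
  · rintro h (x | x) <;> rfl
  · rintro (x | x) g <;> rfl

theorem empty_sum (U : Biset H G) : IsIso (sum (empty H G) U) U := by
  refine ⟨Equiv.emptySum PEmpty _, ?_, ?_⟩
  · rintro h (⟨⟨⟩⟩ | x); rfl
  · rintro (⟨⟨⟩⟩ | x) g; rfl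

theorem prod_congr {U U' : Biset H G} {V V' : Biset H' G'} :
    IsIso U U' → IsIso V V' → IsIso (prod U V) (prod U' V') := by
  rintro ⟨e, el, er⟩ ⟨f, fl, fr⟩
  exact ⟨Equiv.prodCongr e f, fun h x => Prod.ext (el h.1 x.1) (fl h.2 x.2),
    fun x g => Prod.ext (er x.1 g.1) (fr x.2 g.2)⟩

theorem sum_prod (U U' : Biset H G) (V : Biset H' G') :
    IsIso (prod (sum U U') V) (sum (prod U V) (prod U' V)) := by
  refine ⟨Equiv.sumProdDistrib _ _ _, ?_, ?_⟩
  · rintro h ⟨x | x, y⟩ <;> rfl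
  · rintro ⟨x | x, y⟩ g <;> rfl

theorem prod_sum (U : Biset H G) (V V' : Biset H' G') :
    IsIso (prod U (sum V V')) (sum (prod U V) (prod U V')) := by
  refine ⟨Equiv.prodSumDistrib _ _ _, ?_, ?_⟩
  · rintro h ⟨y, x | x⟩ <;> rfl
  · rintro ⟨y, x | x⟩ g <;> rfl

theorem isIso_empty (U : Biset H G) (h : IsEmpty U.X) : IsIso U (empty H G) :=
  ⟨Equiv.equivOfIsEmpty _ PEmpty, fun _ x => h.elim x, fun x => h.elim x⟩

theorem sum_comp (V V' : Biset K H) (U : Biset H G) :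
    IsIso (comp (sum V V') U) (sum (comp V U) (comp V' U)) := by
  refine comp_isIso (W := sum (comp V U) (comp V' U))
    (fun x u => Sum.map (pair · u) (pair · u) x)
    ?_ ?_ ?_ ?_ ?_
  · rintro (v | v) h u
    · exact congrArg Sum.inl (pair_r v h u)
    · exact congrArg Sum.inr (pair_r v h u)
  · rintro k (v | v) u <;> rfl
  · rintro (v | v) u g <;> rfl
  · rintro (v | v) u (v' | v') u' e
    · obtain ⟨h, rfl, rfl⟩ := pair_inj (Sum.inl.inj e)
      exact ⟨h, rfl, rfl⟩
    · cases e
    · cases e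
    · obtain ⟨h, rfl, rfl⟩ := pair_inj (Sum.inr.inj e)
      exact ⟨h, rfl, rfl⟩
  · rintro (⟨v, u⟩ | ⟨v, u⟩)
    · exact ⟨Sum.inl v, u, rfl⟩
    · exact ⟨Sum.inr v, u, rfl⟩

theorem comp_sum (V : Biset K H) (U U' : Biset H G) :
    IsIso (comp V (sum U U')) (sum (comp V U) (comp V U')) := by
  refine comp_isIso (W := sum (comp V U) (comp V U'))
    (fun v x => Sum.map (pair v) (pair v) x)
    ?_ ?_ ?_ ?_ ?_
  · rintro v h (u | u)
    · exact congrArg Sum.inl (pair_r v h u)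
    · exact congrArg Sum.inr (pair_r v h u)
  · rintro k v (u | u) <;> rfl
  · rintro v (u | u) g <;> rfl
  · rintro v (u | u) v' (u' | u') e
    · obtain ⟨h, rfl, rfl⟩ := pair_inj (Sum.inl.inj e)
      exact ⟨h, rfl, rfl⟩
    · cases e
    · cases e
    · obtain ⟨h, rfl, rfl⟩ := pair_inj (Sum.inr.inj e)
      exact ⟨h, rfl, rfl⟩
  · rintro (⟨v, u⟩ | ⟨v, u⟩)
    · exact ⟨v, Sum.inl u, rfl⟩
    · exact ⟨v, Sum.inr u, rfl⟩

theorem empty_comp (U : Biset H G) : IsIso (comp (empty K H) U) (empty K G) :=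
  isIso_empty _ ⟨fun x => x.inductionOn (fun p => nomatch p)⟩

theorem comp_empty (V : Biset K H) : IsIso (comp V (empty H G)) (empty K G) :=
  isIso_empty _ ⟨fun x => x.inductionOn (fun p => nomatch p)⟩

theorem empty_prod (V : Biset H' G') : IsIso (prod (empty H G) V) (empty _ _) :=
  isIso_empty _ ⟨fun p => nomatch p⟩

theorem prod_empty (U : Biset H G) : IsIso (prod U (empty H' G')) (empty _ _) :=
  isIso_empty _ ⟨fun p => nomatch p⟩

theorem toLeft_congr {U V : Biset H G} : IsIso U V → IsIso (toLeft U) (toLeft V) := by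
  rintro ⟨e, el, er⟩
  exact ⟨e, fun p x => (er _ _).trans (congrArg (V.r · _) (el _ _)), fun _ _ => rfl⟩

theorem comp_iso [Finite H] {V : Biset K G} {W : Biset K H} (φ : H ≃* G) (e : V.X ≃ W.X)
    (hl : ∀ k v, e (V.l k v) = W.l k (e v)) (hr : ∀ v h, e (V.r v (φ h)) = W.r (e v) h) :
    IsIso (comp V (iso φ)) W := by
  have hr' : ∀ v g, e (V.r v g) = W.r (e v) (φ.symm g) := fun v g => by
    rw [← hr, φ.apply_symm_apply]
  refine comp_isIso (fun v (g : G) => e (V.r v g)) ?_ ?_ ?_ ?_ ?_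
  · intro v h (u : G)
    exact congrArg e (V.r_mul v h u).symm
  · intro k v (u : G)
    rw [← hl, V.l_r]
  · intro v (u : G) h
    rw [← hr, ← V.r_mul]; rfl
  · intro v (u : G) v' (u' : G) h
    refine ⟨u * u'⁻¹, ?_, by simp [iso]⟩
    rw [V.r_mul, e.injective h, ← V.r_mul, mul_inv_cancel, V.r_one]
  · intro x
    exact ⟨e.symm x, (1 : G), by rw [V.r_one, e.apply_symm_apply]⟩

theorem iso_comp_iso [Finite H] [Finite G] (ψ : G ≃* K) (φ : H ≃* G) :
    IsIso (comp (iso ψ) (iso φ)) (iso (φ.trans ψ)) :=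
  comp_iso φ (Equiv.refl K) (fun _ _ => rfl) fun _ _ => rfl

section slit

variable [Finite L] [Finite K] [Finite H] [Finite G]

/-- Auxiliary biset for the associativity of the composition. -/
def slit₃ (L H G K : Type u) [Group L] [Group K] [Group H] [Group G]
    [Finite L] [Finite K] [Finite H] [Finite G] :
    Biset (L × K) ((L × H) × ((H × G) × (G × K))) where
  X := L × H × G × K
  finite := inferInstance
  l p x := (p.1 * x.1, x.2.1, x.2.2.1, p.2 * x.2.2.2)
  r x q := (x.1 * q.1.1, q.1.2⁻¹ * x.2.1 * q.2.1.1, q.2.1.2⁻¹ * x.2.2.1 * q.2.2.1,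
    x.2.2.2 * q.2.2.2)
  one_l := by simp
  mul_l := by simp [mul_assoc]
  r_one := by simp
  r_mul := by simp [mul_assoc]
  l_r := by simp [mul_assoc]

/-- Auxiliary biset for the associativity of the composition. -/
def slit₃' (L H G K : Type u) [Group L] [Group K] [Group H] [Group G]
    [Finite L] [Finite K] [Finite H] [Finite G] :
    Biset (L × K) (((L × H) × (H × G)) × (G × K)) where
  X := L × H × G × K
  finite := inferInstance
  l p x := (p.1 * x.1, x.2.1, x.2.2.1, p.2 * x.2.2.2)
  r x q := (x.1 * q.1.1.1, q.1.1.2⁻¹ * x.2.1 * q.1.2.1, q.1.2.2⁻¹ * x.2.2.1 * q.2.1,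
    x.2.2.2 * q.2.2)
  one_l := by simp
  mul_l := by simp [mul_assoc]
  r_one := by simp
  r_mul := by simp [mul_assoc]
  l_r := by simp [mul_assoc]

theorem slit_right :
    IsIso (comp (slit L H K) (prod (refl (L × H)) (slit H G K))) (slit₃ L H G K) := by
  refine comp_isIso (W := slit₃ L H G K)
    (fun (v : L × H × K) (u : (L × H) × (H × G × K)) =>
      (v.1 * u.1.1, u.1.2⁻¹ * v.2.1 * u.2.1, u.2.2.1, v.2.2 * u.2.2.2)) ?_ ?_ ?_ ?_ ?_
  · rintro ⟨a, b, c⟩ ⟨⟨d, e⟩, f, g⟩ ⟨⟨h, i⟩, j, k, l⟩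
    simp [slit, prod, refl, mul_assoc]; rfl
  · rintro ⟨d, e⟩ ⟨a, b, c⟩ ⟨⟨h, i⟩, j, k, l⟩
    simp [slit, slit₃, mul_assoc]
  · rintro ⟨a, b, c⟩ ⟨⟨h, i⟩, j, k, l⟩ ⟨⟨d, e⟩, ⟨f, g⟩, m, n⟩
    simp [slit, slit₃, prod, refl, mul_assoc]
  · rintro ⟨a, b, c⟩ ⟨⟨h, i⟩, j, k, l⟩ ⟨a', b', c'⟩ ⟨⟨h', i'⟩, j', k', l'⟩ hyp
    obtain ⟨h1, hyp⟩ := Prod.mk.inj hyp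
    obtain ⟨h2, hyp⟩ := Prod.mk.inj hyp
    obtain ⟨rfl, h4⟩ := Prod.mk.inj hyp
    refine ⟨((h * h'⁻¹, i * i'⁻¹), (j * j'⁻¹, l * l'⁻¹)), ?_, ?_⟩
    · refine Prod.ext ?_ (Prod.ext ?_ ?_)
      · change a' = a * (h * h'⁻¹)
        rw [← mul_assoc, h1]; simp
      · change b' = (i * i'⁻¹)⁻¹ * b * (j * j'⁻¹)
        have : (i * i'⁻¹)⁻¹ * b * (j * j'⁻¹) = i' * (i⁻¹ * b * j) * j'⁻¹ := by group
        rw [this, h2]; group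
      · change c' = c * (l * l'⁻¹)
        rw [← mul_assoc, h4]; simp
    · simp [slit, prod, refl]
  · rintro ⟨a, b, c, d⟩
    exact ⟨(a, b, d), ((1, 1), (1, c, 1)), by simp; rfl⟩

theorem slit_left :
    IsIso (comp (slit L G K) (prod (slit L H G) (refl (G × K)))) (slit₃' L H G K) := by
  refine comp_isIso (W := slit₃' L H G K)
    (fun (v : L × G × K) (u : (L × H × G) × (G × K)) =>
      (v.1 * u.1.1, u.1.2.1, u.1.2.2⁻¹ * v.2.1 * u.2.1, v.2.2 * u.2.2)) ?_ ?_ ?_ ?_ ?_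
  · rintro ⟨a, b, c⟩ ⟨⟨d, e⟩, f, g⟩ ⟨⟨h, i, j⟩, k, l⟩
    simp [slit, prod, refl, mul_assoc]; rfl
  · rintro ⟨d, e⟩ ⟨a, b, c⟩ ⟨⟨h, i, j⟩, k, l⟩
    simp [slit, slit₃', mul_assoc]
  · rintro ⟨a, b, c⟩ ⟨⟨h, i, j⟩, k, l⟩ ⟨⟨⟨d, e⟩, ⟨f, g⟩⟩, m, n⟩
    simp [slit, slit₃', prod, refl, mul_assoc]
  · rintro ⟨a, b, c⟩ ⟨⟨h, i, j⟩, k, l⟩ ⟨a', b', c'⟩ ⟨⟨h', i', j'⟩, k', l'⟩ hyp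
    obtain ⟨h1, hyp⟩ := Prod.mk.inj hyp
    obtain ⟨rfl, hyp⟩ := Prod.mk.inj hyp
    obtain ⟨h2, h4⟩ := Prod.mk.inj hyp
    refine ⟨((h * h'⁻¹, j * j'⁻¹), (k * k'⁻¹, l * l'⁻¹)), ?_, ?_⟩
    · refine Prod.ext ?_ (Prod.ext ?_ ?_)
      · change a' = a * (h * h'⁻¹)
        rw [← mul_assoc, h1]; simp
      · change b' = (j * j'⁻¹)⁻¹ * b * (k * k'⁻¹)
        have : (j * j'⁻¹)⁻¹ * b * (k * k'⁻¹) = j' * (j⁻¹ * b * k) * k'⁻¹ := by group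
        rw [this, h2]; group
      · change c' = c * (l * l'⁻¹)
        rw [← mul_assoc, h4]; simp
    · simp [slit, prod, refl]
  · rintro ⟨a, b, c, d⟩
    exact ⟨(a, c, d), ((1, b, 1), (1, 1)), by simp; rfl⟩

theorem slit_assoc :
    IsIso (comp (comp (slit L G K) (prod (slit L H G) (refl (G × K))))
        (iso (MulEquiv.prodAssoc.symm : (L × H) × ((H × G) × (G × K)) ≃* _)))
      (comp (slit L H K) (prod (refl (L × H)) (slit H G K))) :=
  ((comp_congr slit_left (IsIso.refl _)).trans
    (comp_iso (W := slit₃ L H G K) _ (Equiv.refl _) (fun _ _ => rfl) fun _ _ => rfl)).trans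
    slit_right.symm

theorem slit_one_left :
    IsIso (comp (slit H H K) (prod (toLeft (refl H)) (refl (H × K))))
      (iso (MulEquiv.uniqueProd : PUnit.{u + 1} × (H × K) ≃* H × K)) := by
  refine comp_isIso (W := iso (MulEquiv.uniqueProd : PUnit.{u + 1} × (H × K) ≃* H × K))
    (fun (v : H × H × K) (u : H × (H × K)) => (v.1 * u.1 * v.2.1 * u.2.1, v.2.2 * u.2.2))
    ?_ ?_ ?_ ?_ ?_
  · rintro ⟨a, b, c⟩ ⟨⟨d, e⟩, f, g⟩ ⟨(h : H), i, j⟩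
    simp [slit, prod, refl, toLeft, mul_assoc]; rfl
  · rintro ⟨d, e⟩ ⟨a, b, c⟩ ⟨(h : H), i, j⟩
    simp [slit, iso, mul_assoc]
  · rintro ⟨a, b, c⟩ ⟨(h : H), i, j⟩ ⟨⟨⟩, k, l⟩
    simp [prod, refl, toLeft, iso, mul_assoc]
  · rintro ⟨a, b, c⟩ ⟨(h : H), i, j⟩ ⟨a', b', c'⟩ ⟨(h' : H), i', j'⟩ hyp
    obtain ⟨h1, h2⟩ := Prod.mk.inj hyp
    refine ⟨((a⁻¹ * a', h⁻¹ * a⁻¹ * a' * h'), (i * i'⁻¹, j * j'⁻¹)), ?_, ?_⟩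
    · refine Prod.ext ?_ (Prod.ext ?_ ?_)
      · change a' = a * (a⁻¹ * a')
        simp
      · change b' = (h⁻¹ * a⁻¹ * a' * h')⁻¹ * b * (i * i'⁻¹)
        have : (h⁻¹ * a⁻¹ * a' * h')⁻¹ * b * (i * i'⁻¹)
          = h'⁻¹ * a'⁻¹ * (a * h * b * i) * i'⁻¹ := by group
        rw [this, h1]; group
      · change c' = c * (j * j'⁻¹)
        rw [← mul_assoc, h2]; simp
    · refine Prod.ext ?_ (Prod.ext ?_ ?_)
      · change h' = (a⁻¹ * a')⁻¹ * h * ((h⁻¹ * a⁻¹ * a' * h')⁻¹)⁻¹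
        group
      · change i' = (i * i'⁻¹)⁻¹ * i
        group
      · change j' = (j * j'⁻¹)⁻¹ * j
        group
  · rintro ⟨a, b⟩
    exact ⟨(a, 1, b), ((1 : H), (1, 1)), by simp; rfl⟩

theorem slit_one_right :
    IsIso (comp (slit H G G) (prod (refl (H × G)) (toLeft (refl G))))
      (iso (MulEquiv.prodUnique : (H × G) × PUnit.{u + 1} ≃* H × G)) := by
  refine comp_isIso (W := iso (MulEquiv.prodUnique : (H × G) × PUnit.{u + 1} ≃* H × G))
    (fun (v : H × G × G) (u : (H × G) × G) => (v.1 * u.1.1, v.2.2 * u.2⁻¹ * v.2.1⁻¹ * u.1.2))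
    ?_ ?_ ?_ ?_ ?_
  · rintro ⟨a, b, c⟩ ⟨⟨d, e⟩, f, g⟩ ⟨⟨i, j⟩, (h : G)⟩
    simp [slit, prod, refl, toLeft, mul_assoc]; rfl
  · rintro ⟨d, e⟩ ⟨a, b, c⟩ ⟨⟨i, j⟩, (h : G)⟩
    simp [slit, iso, mul_assoc]
  · rintro ⟨a, b, c⟩ ⟨⟨i, j⟩, (h : G)⟩ ⟨⟨k, l⟩, ⟨⟩⟩
    simp [prod, refl, toLeft, iso, mul_assoc]
  · rintro ⟨a, b, c⟩ ⟨⟨i, j⟩, (h : G)⟩ ⟨a', b', c'⟩ ⟨⟨i', j'⟩, (h' : G)⟩ hyp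
    obtain ⟨h1, h2⟩ := Prod.mk.inj hyp
    refine ⟨((i * i'⁻¹, j * j'⁻¹), (h * c⁻¹ * c' * h'⁻¹, c⁻¹ * c')), ?_, ?_⟩
    · refine Prod.ext ?_ (Prod.ext ?_ ?_)
      · change a' = a * (i * i'⁻¹)
        rw [← mul_assoc, h1]; simp
      · change b' = (j * j'⁻¹)⁻¹ * b * (h * c⁻¹ * c' * h'⁻¹)
        have : (j * j'⁻¹)⁻¹ * b * (h * c⁻¹ * c' * h'⁻¹)
          = j' * (c * h⁻¹ * b⁻¹ * j)⁻¹ * c' * h'⁻¹ := by group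
        rw [this, h2]; group
      · change c' = c * (c⁻¹ * c')
        simp
    · refine Prod.ext (Prod.ext ?_ ?_) ?_
      · change i' = (i * i'⁻¹)⁻¹ * i
        group
      · change j' = (j * j'⁻¹)⁻¹ * j
        group
      · change h' = (h * c⁻¹ * c' * h'⁻¹)⁻¹ * h * ((c⁻¹ * c')⁻¹)⁻¹
        group
  · rintro ⟨a, b⟩
    exact ⟨(a, 1, b), ((1, 1), (1 : G)), by simp; rfl⟩

theorem slit_toLeft (U : Biset H G) (V : Biset G K) :
    IsIso (comp (slit H G K) (prod (toLeft U) (toLeft V)))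
      (comp (toLeft (comp U V))
        (iso (MulEquiv.uniqueProd : PUnit.{u + 1} × PUnit.{u + 1} ≃* PUnit.{u + 1}))) := by
  let T := toLeft (comp U V)
  let W : Biset (H × K) (PUnit.{u + 1} × PUnit.{u + 1}) :=
    { X := T.X
      finite := T.finite
      l := T.l
      r := fun x _ => x
      one_l := T.one_l
      mul_l := T.mul_l
      r_one := fun _ => rfl
      r_mul := fun _ _ _ => rfl
      l_r := fun _ _ _ => rfl }
  refine IsIso.trans (V := W) ?_
    (comp_iso (V := T) (W := W) _ (Equiv.refl _) (fun _ _ => rfl) fun _ _ => rfl).symm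
  refine comp_isIso (W := W)
    (fun (v : H × G × K) (u : U.X × V.X) =>
      (pair (U.r (U.l v.1 u.1) v.2.1) (V.r u.2 v.2.2⁻¹) : (comp U V).X)) ?_ ?_ ?_ ?_ ?_
  · rintro ⟨a, b, c⟩ ⟨⟨d, e⟩, f, g⟩ ⟨(x : U.X), (y : V.X)⟩
    change (pair (U.r (U.l (a * d) x) (e⁻¹ * b * f)) (V.r y (c * g)⁻¹) : (comp U V).X)
      = pair (U.r (U.l a (U.r (U.l d x) e⁻¹)) b) (V.r (V.r (V.l f y) g⁻¹) c⁻¹)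
    rw [V.l_r, V.l_r, ← pair_r]
    simp only [mul_inv_rev, mul_l, l_r, r_mul]
  · rintro ⟨d, e⟩ ⟨a, b, c⟩ ⟨(x : U.X), (y : V.X)⟩
    change (pair (U.r (U.l (d * a) x) b) (V.r y (e * c)⁻¹) : (comp U V).X)
      = pair (U.l d (U.r (U.l a x) b)) (V.r (V.r y c⁻¹) e⁻¹)
    simp only [mul_inv_rev, mul_l, l_r, r_mul]
  · rintro ⟨a, b, c⟩ ⟨x, y⟩ ⟨⟨⟩, ⟨⟩⟩
    rfl
  · rintro ⟨a, b, c⟩ ⟨(x : U.X), (y : V.X)⟩ ⟨a', b', c'⟩ ⟨(x' : U.X), (y' : V.X)⟩ hyp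
    obtain ⟨h, h1, h2⟩ := pair_inj hyp
    change U.r (U.l a' x') b' = U.r (U.r (U.l a x) b) h at h1
    change V.r y' c'⁻¹ = V.l h⁻¹ (V.r y c⁻¹) at h2
    have hx : x' = U.r (U.l (a'⁻¹ * a) x) (b * h * b'⁻¹) := by
      have := congrArg (fun z => U.l a'⁻¹ (U.r z b'⁻¹)) h1
      simpa [← r_mul, ← mul_l, l_r, r_one, one_l, mul_assoc] using this
    have hy : y' = V.l h⁻¹ (V.r y (c⁻¹ * c')) := by
      have := congrArg (fun z => V.r z c') h2
      simpa [← r_mul, ← mul_l, l_r, r_one, one_l, mul_assoc] using this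
    refine ⟨((a⁻¹ * a', b * h * b'⁻¹), (h, c⁻¹ * c')), ?_, ?_⟩
    · refine Prod.ext ?_ (Prod.ext ?_ ?_)
      · change a' = a * (a⁻¹ * a')
        simp
      · change b' = (b * h * b'⁻¹)⁻¹ * b * h
        group
      · change c' = c * (c⁻¹ * c')
        simp
    · refine Prod.ext ?_ ?_
      · change x' = U.r (U.l (a⁻¹ * a')⁻¹ x) ((b * h * b'⁻¹)⁻¹)⁻¹
        rw [hx]; simp
      · change y' = V.r (V.l h⁻¹ y) ((c⁻¹ * c')⁻¹)⁻¹
        rw [hy]; simp [l_r]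
  · rintro ⟨x, y⟩
    refine ⟨(1, 1, 1), (x, y), ?_⟩
    simp [one_l, r_one]; rfl

end slit

end Biset

/-- The commutative monoid of isomorphism classes of finite `(H, G)`-bisets under disjoint union. -/
def BisetClass (H G : Type u) [Group H] [Group G] : Type (u + 1) := Quotient (Biset.isoSetoid H G)

namespace BisetClass

variable {K H G H' G' : Type u} [Group K] [Group H] [Group G] [Group H'] [Group G']

/-- The isomorphism class of a biset. -/
def cls (U : Biset H G) : BisetClass H G := Quotient.mk _ U

theorem cls_eq {U V : Biset H G} (h : U.IsIso V) : cls U = cls V := Quotient.sound h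

instance : Zero (BisetClass H G) := ⟨cls (Biset.empty H G)⟩

instance : Add (BisetClass H G) :=
  ⟨Quotient.map₂ Biset.sum fun _ _ h _ _ h' => Biset.sum_congr h h'⟩

instance : AddCommMonoid (BisetClass H G) where
  add_assoc := by rintro ⟨a⟩ ⟨b⟩ ⟨c⟩; exact cls_eq (Biset.sum_assoc a b c)
  add_comm := by rintro ⟨a⟩ ⟨b⟩; exact cls_eq (Biset.sum_comm a b)
  zero_add := by rintro ⟨a⟩; exact cls_eq (Biset.empty_sum a)
  add_zero := by
    rintro ⟨a⟩; exact cls_eq ((Biset.sum_comm a _).trans (Biset.empty_sum a))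
  nsmul := nsmulRec

/-- Composition of classes of bisets. -/
def comp : BisetClass K H →+ BisetClass H G →+ BisetClass K G where
  toFun v :=
    { toFun := Quotient.map₂ Biset.comp (fun _ _ h _ _ h' => Biset.comp_congr h h') v
      map_zero' := by
        obtain ⟨v⟩ := v; exact cls_eq (Biset.comp_empty v)
      map_add' := by
        obtain ⟨v⟩ := v; rintro ⟨a⟩ ⟨b⟩; exact cls_eq (Biset.comp_sum v a b) }
  map_zero' := by
    ext ⟨u⟩; exact cls_eq (Biset.empty_comp u)
  map_add' := by
    rintro ⟨a⟩ ⟨b⟩; ext ⟨u⟩; exact cls_eq (Biset.sum_comp a b u)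

/-- External product of classes of bisets. -/
def prod : BisetClass H G →+ BisetClass H' G' →+ BisetClass (H × H') (G × G') where
  toFun v :=
    { toFun := Quotient.map₂ Biset.prod (fun _ _ h _ _ h' => Biset.prod_congr h h') v
      map_zero' := by
        obtain ⟨v⟩ := v; exact cls_eq (Biset.prod_empty v)
      map_add' := by
        obtain ⟨v⟩ := v; rintro ⟨a⟩ ⟨b⟩; exact cls_eq (Biset.prod_sum v a b) }
  map_zero' := by
    ext ⟨u⟩; exact cls_eq (Biset.empty_prod u)
  map_add' := by
    rintro ⟨a⟩ ⟨b⟩; ext ⟨u⟩; exact cls_eq (Biset.sum_prod a b u)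

end BisetClass

open scoped TensorProduct

/-- `RB(H, G) = R ⊗ B(H, G)`, where `B(H, G)` is the Grothendieck group of finite
`(H, G)`-bisets. -/
def RB (R : Type r) [CommRing R] (H G : Type u) [Group H] [Group G] : Type (max r (u + 1)) :=
  R ⊗[ℤ] Algebra.GrothendieckAddGroup (BisetClass H G)

namespace RB

variable {R : Type r} [CommRing R]
variable {L K H G H' G' : Type u} [Group L] [Group K] [Group H] [Group G] [Group H'] [Group G']

noncomputable instance : AddCommGroup (RB R H G) :=
  inferInstanceAs (AddCommGroup (R ⊗[ℤ] Algebra.GrothendieckAddGroup (BisetClass H G)))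

noncomputable instance : Module R (RB R H G) :=
  inferInstanceAs (Module R (R ⊗[ℤ] Algebra.GrothendieckAddGroup (BisetClass H G)))

variable (R) in
/-- The element of `RB(H, G)` given by a class of bisets. -/
noncomputable def ofClass : BisetClass H G →+ RB R H G where
  toFun x := (1 : R) ⊗ₜ[ℤ] Algebra.GrothendieckAddGroup.of x
  map_zero' := by rw [map_zero, TensorProduct.tmul_zero]; rfl
  map_add' x y := by rw [map_add, TensorProduct.tmul_add]; rfl

variable (R) in
/-- The element of `RB(H, G)` given by a biset. -/
noncomputable def of (U : Biset H G) : RB R H G := ofClass R (BisetClass.cls U)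

theorem of_eq {U V : Biset H G} (h : U.IsIso V) : of R U = of R V :=
  congrArg (ofClass R) (BisetClass.cls_eq h)

/-- Universal property of `RB(H, G)`. -/
noncomputable def lift {N : Type*} [AddCommGroup N] [Module R N] (f : BisetClass H G →+ N) :
    RB R H G →ₗ[R] N :=
  LinearMap.liftBaseChange R (Algebra.GrothendieckAddGroup.lift f).toIntLinearMap

theorem lift_ofClass {N : Type*} [AddCommGroup N] [Module R N] (f : BisetClass H G →+ N)
    (x : BisetClass H G) : lift f (ofClass R x) = f x := by
  have h : (Algebra.GrothendieckAddGroup.lift f) (Algebra.GrothendieckAddGroup.of x) = f x :=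
    DFunLike.congr_fun (Algebra.GrothendieckAddGroup.lift.symm_apply_apply f) x
  refine (LinearMap.liftBaseChange_tmul _ _ _ _).trans ?_
  rw [one_smul]
  exact h

theorem hom_ext {N : Type*} [AddCommGroup N] [Module R N] {f g : RB R H G →ₗ[R] N}
    (h : ∀ U, f (of R U) = g (of R U)) : f = g := by
  have h' : ∀ x, f (ofClass R x) = g (ofClass R x) := by rintro ⟨U⟩; exact h U
  refine (LinearMap.liftBaseChangeEquiv R).symm.injective ?_
  have : (((LinearMap.liftBaseChangeEquiv R).symm f).toAddMonoidHom
    : Algebra.GrothendieckAddGroup (BisetClass H G) →+ N)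
      = ((LinearMap.liftBaseChangeEquiv R).symm g).toAddMonoidHom := by
    refine Algebra.GrothendieckAddGroup.lift.symm.injective ?_
    ext x
    exact h' x
  ext x
  exact DFunLike.congr_fun this x

/-- Extension of a biadditive operation on bisets to a bilinear one. -/
noncomputable def bilin {H₁ G₁ H₂ G₂ H₃ G₃ : Type u} [Group H₁] [Group G₁] [Group H₂] [Group G₂]
    [Group H₃] [Group G₃] (f : BisetClass H₁ G₁ →+ BisetClass H₂ G₂ →+ BisetClass H₃ G₃) :
    RB R H₁ G₁ →ₗ[R] RB R H₂ G₂ →ₗ[R] RB R H₃ G₃ :=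
  lift
    { toFun := fun x => lift ((ofClass R).comp (f x))
      map_zero' := hom_ext fun U => by
        rw [of, lift_ofClass]; simp
      map_add' := fun x y => hom_ext fun U => by
        rw [of, LinearMap.add_apply]; simp only [lift_ofClass]; simp }

theorem bilin_ofClass {H₁ G₁ H₂ G₂ H₃ G₃ : Type u} [Group H₁] [Group G₁] [Group H₂] [Group G₂]
    [Group H₃] [Group G₃] (f : BisetClass H₁ G₁ →+ BisetClass H₂ G₂ →+ BisetClass H₃ G₃)
    (x : BisetClass H₁ G₁) (y : BisetClass H₂ G₂) :
    bilin f (ofClass R x) (ofClass R y) = ofClass R (f x y) := by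
  rw [bilin, lift_ofClass]
  exact lift_ofClass _ _

/-- The bilinear composition `RB(K, H) × RB(H, G) → RB(K, G)`, `(V, U) ↦ V ×_H U`. -/
noncomputable def comp : RB R K H →ₗ[R] RB R H G →ₗ[R] RB R K G := bilin BisetClass.comp

theorem comp_of (V : Biset K H) (U : Biset H G) :
    comp (of R V) (of R U) = of R (V.comp U) := bilin_ofClass _ _ _

/-- The bilinear product `RB(H, G) × RB(H', G') → RB(H × H', G × G')`, `(U, V) ↦ U × V`. -/
noncomputable def prod : RB R H G →ₗ[R] RB R H' G' →ₗ[R] RB R (H × H') (G × G') :=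
  bilin BisetClass.prod

theorem prod_of (U : Biset H G) (V : Biset H' G') :
    prod (of R U) (of R V) = of R (U.prod V) := bilin_ofClass _ _ _

theorem comp_assoc (w : RB R L K) (v : RB R K H) (u : RB R H G) :
    comp (comp w v) u = comp w (comp v u) := by
  refine LinearMap.congr_fun (f := comp.flip u ∘ₗ comp.flip v) (g := comp.flip (comp v u))
    (hom_ext fun W => ?_) w
  refine LinearMap.congr_fun (f := comp.flip u ∘ₗ comp (of R W))
    (g := comp (of R W) ∘ₗ comp.flip u) (hom_ext fun V => ?_) v
  refine LinearMap.congr_fun (f := comp (comp (of R W) (of R V)))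
    (g := comp (of R W) ∘ₗ comp (of R V)) (hom_ext fun U => ?_) u
  rw [LinearMap.comp_apply, comp_of, comp_of, comp_of, comp_of, of_eq (Biset.comp_assoc W V U)]

theorem refl_comp [Finite H] (u : RB R H G) : comp (of R (Biset.refl H)) u = u :=
  LinearMap.congr_fun (hom_ext (f := comp (of R (Biset.refl H))) (g := LinearMap.id) fun U => by
    rw [comp_of, of_eq (Biset.refl_comp U)]; rfl) u

theorem comp_refl [Finite G] (u : RB R H G) : comp u (of R (Biset.refl G)) = u :=
  LinearMap.congr_fun (hom_ext (f := comp.flip (of R (Biset.refl G))) (g := LinearMap.id)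
    fun U => by rw [LinearMap.flip_apply, comp_of, of_eq (Biset.comp_refl U)]; rfl) u

end RB

/-- A class of finite groups closed under subquotients and direct products. A subquotient of `G`
is the image of a group homomorphism defined on a subgroup of `G`. The class is not empty, and
hence contains the trivial groups. -/
structure GroupClass where
  mem : ∀ (G : Type u) [Group G], Prop
  finite : ∀ (G : Type u) [Group G], mem G → Finite G
  nonempty : ∃ (G : Type u) (_ : Group G), mem G
  subquotient : ∀ (G Q : Type u) [Group G] [Group Q] (D : Subgroup G) (f : D →* Q),
    mem G → Function.Surjective f → mem Q
  prod : ∀ (G H : Type u) [Group G] [Group H], mem G → mem H → mem (G × H)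

/-- An object of the biset category: a group in the class `Z`. -/
structure BisetCat (R : Type r) [CommRing R] (Z : GroupClass.{u}) : Type (u + 1) where
  carrier : Type u
  [group : Group carrier]
  mem : Z.mem carrier

namespace BisetCat

variable {R : Type r} [CommRing R] {Z : GroupClass.{u}}

instance : CoeSort (BisetCat R Z) (Type u) := ⟨carrier⟩

instance (G : BisetCat R Z) : Group G := G.group

instance (G : BisetCat R Z) : Finite G := Z.finite G G.mem

/-- The direct product of two groups in `Z`. -/
abbrev prod (G H : BisetCat R Z) : BisetCat R Z := ⟨G × H, Z.prod G H G.mem H.mem⟩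

/-- The trivial group. -/
abbrev unit : BisetCat R Z :=
  ⟨PUnit.{u + 1}, by
    obtain ⟨G, _, hG⟩ := Z.nonempty
    exact Z.subquotient G PUnit ⊤ 1 hG fun _ => ⟨1, rfl⟩⟩

open CategoryTheory

/-- The biset category: a morphism from `G` to `H` is an element of `RB(H, G)`. -/
noncomputable instance : Category (BisetCat R Z) where
  Hom G H := RB R H G
  id G := RB.of R (Biset.refl G)
  comp f g := RB.comp g f
  id_comp f := RB.comp_refl f
  comp_id f := RB.refl_comp f
  assoc f g h := (RB.comp_assoc h g f).symm

noncomputable instance : Preadditive (BisetCat R Z) where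
  homGroup G H := inferInstanceAs (AddCommGroup (RB R H G))
  add_comp P Q S (f f' : RB R Q P) (g : RB R S Q) := map_add (RB.comp g) f f'
  comp_add P Q S (f : RB R Q P) (g g' : RB R S Q) := LinearMap.map_add₂ RB.comp g g' f

noncomputable instance : Linear R (BisetCat R Z) where
  homModule G H := inferInstanceAs (Module R (RB R H G))
  smul_comp P Q S c (f : RB R Q P) (g : RB R S Q) := map_smul (RB.comp g) c f
  comp_smul P Q S (f : RB R Q P) c (g : RB R S Q) := LinearMap.map_smul₂ RB.comp c g f

/-- An element of `RB(H, G)` as a morphism from `G` to `H`. -/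
def hom {G H : BisetCat R Z} (α : RB R H G) : G ⟶ H := α

end BisetCat

/-- A biset functor on the class `Z` over `R`: an `R`-linear functor from the biset category
to `R`-modules. -/
structure BisetFunctor (R : Type r) [CommRing R] (Z : GroupClass.{u}) where
  toFunctor : CategoryTheory.Functor (BisetCat R Z) (ModuleCat.{w} R)
  additive : toFunctor.Additive
  linear : toFunctor.Linear R

namespace BisetFunctor

variable {R : Type r} [CommRing R] {Z : GroupClass.{u}}

/-- The value `M(G)`. -/
abbrev obj (M : BisetFunctor.{u, r, w} R Z) (G : BisetCat R Z) : Type w := M.toFunctor.obj G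

/-- The map `M(α) : M(G) → M(H)` for `α` in `RB(H, G)`. -/
noncomputable def map (M : BisetFunctor.{u, r, w} R Z) {G H : BisetCat R Z} (α : RB R H G) :
    M.obj G →ₗ[R] M.obj H := (M.toFunctor.map (BisetCat.hom α)).hom

theorem map_refl (M : BisetFunctor.{u, r, w} R Z) {G : BisetCat R Z} (x : M.obj G) :
    M.map (RB.of R (Biset.refl G)) x = x := by
  have := M.toFunctor.map_id G
  exact LinearMap.congr_fun (congrArg ModuleCat.Hom.hom this) x

theorem map_map (M : BisetFunctor.{u, r, w} R Z) {G H K : BisetCat R Z} (β : RB R K H)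
    (α : RB R H G) (x : M.obj G) : M.map β (M.map α x) = M.map (RB.comp β α) x := by
  have := M.toFunctor.map_comp (BisetCat.hom α) (BisetCat.hom β)
  exact (LinearMap.congr_fun (congrArg ModuleCat.Hom.hom this) x).symm

/-- `H` is minimal for `M` if `M(H) ≠ 0` and `M` vanishes on the groups in `Z` of smaller order. -/
def IsMinimal (M : BisetFunctor.{u, r, w} R Z) (H : BisetCat R Z) : Prop :=
  Nontrivial (M.obj H) ∧ ∀ K : BisetCat R Z, Nat.card K < Nat.card H → Subsingleton (M.obj K)

end BisetFunctor

/-- A Green biset functor: a biset functor `A` with bilinear products `A(G) × A(H) → A(G × H)`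
and an element `ε` of `A(1)` that are associative, unital and functorial. -/
structure GreenBisetFunctor (R : Type r) [CommRing R] (Z : GroupClass.{u}) extends
    BisetFunctor.{u, r, w} R Z where
  mul : ∀ {G H : BisetCat R Z},
    toBisetFunctor.obj G →ₗ[R] toBisetFunctor.obj H →ₗ[R] toBisetFunctor.obj (G.prod H)
  ε : toBisetFunctor.obj BisetCat.unit
  mul_assoc : ∀ {G H K : BisetCat R Z} (a : toBisetFunctor.obj G) (b : toBisetFunctor.obj H)
    (c : toBisetFunctor.obj K),
    mul (mul a b) c = toBisetFunctor.map (G := G.prod (H.prod K)) (H := (G.prod H).prod K)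
      (RB.of R (Biset.iso (MulEquiv.prodAssoc.symm : G × (H × K) ≃* (G × H) × K)))
      (mul a (mul b c))
  one_mul : ∀ {G : BisetCat R Z} (a : toBisetFunctor.obj G),
    toBisetFunctor.map (G := BisetCat.unit.prod G)
      (RB.of R (Biset.iso (MulEquiv.uniqueProd : PUnit.{u + 1} × G ≃* G))) (mul ε a) = a
  mul_one : ∀ {G : BisetCat R Z} (a : toBisetFunctor.obj G),
    toBisetFunctor.map (G := G.prod BisetCat.unit)
      (RB.of R (Biset.iso (MulEquiv.prodUnique : G × PUnit.{u + 1} ≃* G))) (mul a ε) = a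
  map_mul : ∀ {G G' H H' : BisetCat R Z} (φ : RB R G' G) (ψ : RB R H' H)
    (a : toBisetFunctor.obj G) (b : toBisetFunctor.obj H),
    toBisetFunctor.map (G := G.prod H) (H := G'.prod H') (RB.prod φ ψ) (mul a b)
      = mul (toBisetFunctor.map φ a) (toBisetFunctor.map ψ b)

namespace GreenBisetFunctor

variable {R : Type r} [CommRing R] {Z : GroupClass.{u}} (A : GreenBisetFunctor.{u, r, w} R Z)

/-- The composition `β ∘ α = A(H × G⃖ × K)(β × α)` of `β` in `A(H × G)` and `α` in
`A(G × K)`. -/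
noncomputable def comp {H G K : BisetCat R Z} :
    A.obj (H.prod G) →ₗ[R] A.obj (G.prod K) →ₗ[R] A.obj (H.prod K) :=
  A.mul.compr₂ (A.map (G := (H.prod G).prod (G.prod K)) (H := H.prod K)
    (RB.of R (Biset.slit H G K)))

/-- The element of `A(H × G)` associated with an `(H, G)`-biset. -/
noncomputable def ofBiset {H G : BisetCat R Z} (U : Biset H G) : A.obj (H.prod G) :=
  A.map (G := BisetCat.unit) (H := H.prod G) (RB.of R U.toLeft) A.ε

/-- The identity of `H` for the composition. -/
noncomputable def id (H : BisetCat R Z) : A.obj (H.prod H) := A.ofBiset (Biset.refl H)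

theorem comp_map {H G K X Y : BisetCat R Z} (φ : RB R (H × G) X) (ψ : RB R (G × K) Y)
    (a : A.obj X) (b : A.obj Y) :
    A.comp (A.map (H := H.prod G) φ a) (A.map (H := G.prod K) ψ b)
      = A.map (G := X.prod Y) (H := H.prod K)
        (RB.comp (RB.of R (Biset.slit H G K)) (RB.prod φ ψ)) (A.mul a b) :=
  (congrArg (A.map (G := (H.prod G).prod (G.prod K)) (H := H.prod K)
    (RB.of R (Biset.slit H G K)))
    (A.map_mul (G := X) (G' := H.prod G) (H := Y) (H' := G.prod K) φ ψ a b).symm).trans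
    (A.map_map (G := X.prod Y) (H := (H.prod G).prod (G.prod K)) (K := H.prod K) _ _ _)

theorem comp_assoc {L H G K : BisetCat R Z} (γ : A.obj (L.prod H)) (β : A.obj (H.prod G))
    (α : A.obj (G.prod K)) : A.comp (A.comp γ β) α = A.comp γ (A.comp β α) := by
  have h1 := A.comp_map (RB.of R (Biset.slit L H G)) (RB.of R (Biset.refl (G × K)))
    (X := (L.prod H).prod (H.prod G)) (Y := G.prod K) (A.mul γ β) α
  have h2 := A.comp_map (RB.of R (Biset.refl (L × H))) (RB.of R (Biset.slit H G K))
    (X := L.prod H) (Y := (H.prod G).prod (G.prod K)) γ (A.mul β α)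
  have e1 := A.map_refl (G := G.prod K) α
  have e2 := A.map_refl (G := L.prod H) γ
  rw [RB.prod_of, RB.comp_of] at h1 h2
  refine (congrArg (A.comp (A.comp γ β)) e1.symm).trans (h1.trans ?_)
  refine Eq.trans ?_ (h2.symm.trans (congrArg (fun x => A.comp x (A.comp β α)) e2))
  refine (congrArg _ (A.mul_assoc γ β α)).trans ?_
  refine (A.map_map (G := (L.prod H).prod ((H.prod G).prod (G.prod K))) (K := L.prod K)
    _ _ _).trans ?_
  rw [RB.comp_of, RB.of_eq Biset.slit_assoc]

theorem id_comp {H K : BisetCat R Z} (α : A.obj (H.prod K)) : A.comp (A.id H) α = α := by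
  have h1 := A.comp_map (RB.of R (Biset.refl H).toLeft) (RB.of R (Biset.refl (H × K)))
    (X := BisetCat.unit) (Y := H.prod K) A.ε α
  have e1 := A.map_refl (G := H.prod K) α
  rw [RB.prod_of, RB.comp_of, RB.of_eq Biset.slit_one_left] at h1
  exact (congrArg (A.comp (A.id H)) e1.symm).trans (h1.trans (A.one_mul (G := H.prod K) α))

theorem comp_id {H G : BisetCat R Z} (α : A.obj (H.prod G)) : A.comp α (A.id G) = α := by
  have h1 := A.comp_map (RB.of R (Biset.refl (H × G))) (RB.of R (Biset.refl G).toLeft)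
    (X := H.prod G) (Y := BisetCat.unit) α A.ε
  have e1 := A.map_refl (G := H.prod G) α
  rw [RB.prod_of, RB.comp_of, RB.of_eq Biset.slit_one_right] at h1
  exact (congrArg (fun x => A.comp x (A.id G)) e1.symm).trans
    (h1.trans (A.mul_one (G := H.prod G) α))

theorem ofBiset_eq {H G : BisetCat R Z} {U V : Biset H G} (h : U.IsIso V) :
    A.ofBiset U = A.ofBiset V := by
  rw [ofBiset, ofBiset, RB.of_eq (Biset.toLeft_congr h)]

theorem ofBiset_comp {H G K : BisetCat R Z} (U : Biset H G) (V : Biset G K) :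
    A.comp (A.ofBiset U) (A.ofBiset V) = A.ofBiset (U.comp V) := by
  have h1 := A.comp_map (RB.of R U.toLeft) (RB.of R V.toLeft)
    (X := BisetCat.unit) (Y := BisetCat.unit) A.ε A.ε
  rw [RB.prod_of, RB.comp_of, RB.of_eq (Biset.slit_toLeft U V), ← RB.comp_of] at h1
  exact h1.trans ((A.map_map (G := BisetCat.unit.prod BisetCat.unit) (H := BisetCat.unit)
    (K := H.prod K) _ _ _).symm.trans
    (congrArg (A.map (G := BisetCat.unit) (H := H.prod K) (RB.of R (U.comp V).toLeft))
      (A.one_mul (G := BisetCat.unit) A.ε)))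

/-- The underlying `R`-module of the algebra `A(H × H)`. -/
def EndAlg (H : BisetCat R Z) : Type w := A.obj (H.prod H)

variable {A} in
/-- An element of `A(H × H)` as an element of the algebra. -/
noncomputable def toEndAlg {H : BisetCat R Z} (a : A.obj (H.prod H)) : A.EndAlg H := a

noncomputable instance (H : BisetCat R Z) : AddCommGroup (A.EndAlg H) :=
  inferInstanceAs (AddCommGroup (A.obj (H.prod H)))

noncomputable instance (H : BisetCat R Z) : Module R (A.EndAlg H) :=
  inferInstanceAs (Module R (A.obj (H.prod H)))

/-- The ring structure on `A(H × H)` given by the composition. -/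
noncomputable instance (H : BisetCat R Z) : Ring (A.EndAlg H) where
  __ := (inferInstance : AddCommGroup (A.EndAlg H))
  mul a b := A.comp (H := H) (G := H) (K := H) a b
  one := A.id H
  left_distrib a b c := map_add (A.comp (H := H) (G := H) (K := H) a) b c
  right_distrib a b c := LinearMap.map_add₂ (A.comp (H := H) (G := H) (K := H)) a b c
  zero_mul a := LinearMap.map_zero₂ (A.comp (H := H) (G := H) (K := H)) a
  mul_zero a := map_zero (A.comp (H := H) (G := H) (K := H) a)
  mul_assoc a b c := A.comp_assoc (L := H) (H := H) (G := H) (K := H) a b c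
  one_mul a := A.id_comp (H := H) (K := H) a
  mul_one a := A.comp_id (H := H) (G := H) a

/-- The submodule `I_A(H)` of `A(H × H)` generated by the `a ∘ b` that factor through a group in
`Z` of order smaller than that of `H`. -/
noncomputable def I (H : BisetCat R Z) : Submodule R (A.EndAlg H) :=
  Submodule.span R {x | ∃ (K : BisetCat R Z) (a : A.obj (H.prod K)) (b : A.obj (K.prod H)),
    Nat.card K < Nat.card H ∧ x = A.comp a b}

theorem mul_mem_I {H : BisetCat R Z} (c : A.EndAlg H) {x : A.EndAlg H} (hx : x ∈ A.I H) :
    c * x ∈ A.I H := by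
  induction hx using Submodule.span_induction with
  | mem x h =>
    obtain ⟨K, a, b, hK, rfl⟩ := h
    exact Submodule.subset_span
      ⟨K, A.comp (H := H) (G := H) c a, b, hK, (A.comp_assoc (L := H) (H := H) c a b).symm⟩
  | zero => rw [mul_zero]; exact zero_mem _
  | add x y _ _ hx hy => rw [mul_add]; exact add_mem hx hy
  | smul r x _ hx =>
    have : c * (r • x) = r • (c * x) := map_smul (A.comp (H := H) (G := H) (K := H) c) r x
    rw [this]; exact Submodule.smul_mem _ _ hx

theorem I_mul_mem {H : BisetCat R Z} (c : A.EndAlg H) {x : A.EndAlg H} (hx : x ∈ A.I H) :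
    x * c ∈ A.I H := by
  induction hx using Submodule.span_induction with
  | mem x h =>
    obtain ⟨K, a, b, hK, rfl⟩ := h
    exact Submodule.subset_span
      ⟨K, a, A.comp (G := H) (K := H) b c, hK, A.comp_assoc (G := H) (K := H) a b c⟩
  | zero => rw [zero_mul]; exact zero_mem _
  | add x y _ _ hx hy => rw [add_mul]; exact add_mem hx hy
  | smul r x _ hx =>
    have : (r • x) * c = r • (x * c) :=
      LinearMap.map_smul₂ (A.comp (H := H) (G := H) (K := H)) r x c
    rw [this]; exact Submodule.smul_mem _ _ hx

/-- `I_A(H)` as an ideal. -/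
noncomputable def ideal (H : BisetCat R Z) : Ideal (A.EndAlg H) where
  __ := (A.I H).toAddSubmonoid
  smul_mem' c _ hx := A.mul_mem_I c hx

instance (H : BisetCat R Z) : (A.ideal H).IsTwoSided := ⟨fun c hx => A.I_mul_mem c hx⟩

/-- The algebra `Â(H) = A(H × H) / I_A(H)`. -/
abbrev Hat (H : BisetCat R Z) : Type w := A.EndAlg H ⧸ A.ideal H

variable {A} in
/-- The class in `Â(H)` of an element of `A(H × H)`. -/
noncomputable def toHat {H : BisetCat R Z} (a : A.obj (H.prod H)) : A.Hat H := Ideal.Quotient.mk (A.ideal H) a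

/-- The isomorphism `A(Iso(φ))(ε)` in `A(G × H)` from `H` to `G` given by a group isomorphism
`φ : H → G`. -/
noncomputable def isoElt {H G : BisetCat R Z} (φ : H ≃* G) : A.obj (G.prod H) := A.ofBiset (Biset.iso φ)

theorem isoElt_refl (H : BisetCat R Z) : A.isoElt (MulEquiv.refl H) = A.id H := rfl

theorem isoElt_comp {H G K : BisetCat R Z} (ψ : G ≃* K) (φ : H ≃* G) :
    A.comp (A.isoElt ψ) (A.isoElt φ) = A.isoElt (φ.trans ψ) := by
  rw [isoElt, isoElt, isoElt, A.ofBiset_comp, A.ofBiset_eq (Biset.iso_comp_iso ψ φ)]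

/-- For a group isomorphism `φ : H → G`, the transport `a ↦ α₁ ∘ a ∘ α₂` from `A(H × H)` to
`A(G × G)`, where `α₁` and `α₂` are the elements given by `φ` and `φ⁻¹`. -/
noncomputable def conj {H G : BisetCat R Z} (φ : H ≃* G) (a : A.obj (H.prod H)) : A.obj (G.prod G) :=
  A.comp (A.isoElt φ) (A.comp a (A.isoElt φ.symm))

theorem conj_refl (H : BisetCat R Z) (a : A.obj (H.prod H)) : A.conj (MulEquiv.refl H) a = a := by
  have h : A.isoElt (MulEquiv.refl H).symm = A.id H := rfl
  rw [conj, h, isoElt_refl, A.id_comp, A.comp_id]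

theorem conj_conj {H G K : BisetCat R Z} (ψ : G ≃* K) (φ : H ≃* G) (a : A.obj (H.prod H)) :
    A.conj ψ (A.conj φ a) = A.conj (φ.trans ψ) a := by
  have h : A.isoElt (φ.trans ψ).symm = A.comp (A.isoElt φ.symm) (A.isoElt ψ.symm) :=
    (A.isoElt_comp φ.symm ψ.symm).symm
  simp only [conj, h, ← A.isoElt_comp ψ φ, A.comp_assoc]

/-- A couple `(H, V)` with `H` in `Z`, `Â(H) ≠ 0` and `V` a simple `Â(H)`-module. -/
structure Seed where
  H : BisetCat R Z
  V : Type w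
  [addCommGroup : AddCommGroup V]
  [module : Module (A.Hat H) V]
  nontrivial : Nontrivial (A.Hat H)
  simple : IsSimpleModule (A.Hat H) V

attribute [instance] Seed.addCommGroup Seed.module

/-- `(H, V) ∼ (G, W)`: there is a group isomorphism `φ : H → G` such that `V` is isomorphic to
`^φ W`, the module `W` on which `a` in `A(H × H)` acts as `α₁ ∘ a ∘ α₂` in `A(G × G)`. -/
instance seedSetoid : Setoid A.Seed where
  r P Q := ∃ (φ : P.H ≃* Q.H) (e : P.V ≃+ Q.V), ∀ (a : A.obj (P.H.prod P.H)) (v : P.V),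
    e (toHat a • v) = toHat (A.conj φ a) • e v
  iseqv := by
    refine ⟨fun P => ⟨MulEquiv.refl _, AddEquiv.refl _, fun a v => ?_⟩, ?_, ?_⟩
    · rw [A.conj_refl]; rfl
    · rintro P Q ⟨φ, e, h⟩
      refine ⟨φ.symm, e.symm, fun a v => ?_⟩
      rw [AddEquiv.symm_apply_eq, h, A.conj_conj, AddEquiv.apply_symm_apply,
        MulEquiv.symm_trans_self, A.conj_refl]
    · rintro P Q S ⟨φ, e, h⟩ ⟨ψ, f, k⟩
      refine ⟨φ.trans ψ, e.trans f, fun a v => ?_⟩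
      rw [← A.conj_conj, AddEquiv.trans_apply, h, k]; rfl

/-- The set of equivalence classes of couples `(H, V)`. -/
abbrev SeedClass := Quotient A.seedSetoid

end GreenBisetFunctor

/-- A module over a Green biset functor `A`: a biset functor `M` with bilinear products
`A(G) × M(H) → M(G × H)` that are associative, unital and functorial. -/
structure GreenModule {R : Type r} [CommRing R] {Z : GroupClass.{u}}
    (A : GreenBisetFunctor.{u, r, w} R Z) extends BisetFunctor.{u, r, w} R Z where
  smul : ∀ {G H : BisetCat R Z},
    A.obj G →ₗ[R] toBisetFunctor.obj H →ₗ[R] toBisetFunctor.obj (G.prod H)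
  mul_smul : ∀ {G H K : BisetCat R Z} (a : A.obj G) (b : A.obj H) (m : toBisetFunctor.obj K),
    smul (A.mul a b) m = toBisetFunctor.map (G := G.prod (H.prod K)) (H := (G.prod H).prod K)
      (RB.of R (Biset.iso (MulEquiv.prodAssoc.symm : G × (H × K) ≃* (G × H) × K)))
      (smul a (smul b m))
  one_smul : ∀ {G : BisetCat R Z} (m : toBisetFunctor.obj G),
    toBisetFunctor.map (G := BisetCat.unit.prod G)
      (RB.of R (Biset.iso (MulEquiv.uniqueProd : PUnit.{u + 1} × G ≃* G))) (smul A.ε m) = m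
  map_smul : ∀ {G G' H H' : BisetCat R Z} (φ : RB R G' G) (ψ : RB R H' H)
    (a : A.obj G) (m : toBisetFunctor.obj H),
    toBisetFunctor.map (G := G.prod H) (H := G'.prod H') (RB.prod φ ψ) (smul a m)
      = smul (A.map φ a) (toBisetFunctor.map ψ m)

namespace GreenModule

variable {R : Type r} [CommRing R] {Z : GroupClass.{u}} {A : GreenBisetFunctor.{u, r, w} R Z}

/-- The action `M(α) : M(H) → M(G)`, `m ↦ M(G × H⃖)(α × m)`, of `α` in `A(G × H)`. -/
noncomputable def act (M : GreenModule A) {G H : BisetCat R Z} :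
    A.obj (G.prod H) →ₗ[R] M.obj H →ₗ[R] M.obj G :=
  M.smul.compr₂ (M.map (G := (G.prod H).prod H) (H := G) (RB.of R (Biset.slitAct G H)))

/-- A submodule of an `A`-module: submodules `N(G)` of the `M(G)`, stable under the bisets and
under the products with elements of `A`. -/
structure Sub (M : GreenModule A) where
  carrier : ∀ G : BisetCat R Z, Submodule R (M.obj G)
  map_mem : ∀ {G H : BisetCat R Z} (α : RB R H G) (m : M.obj G),
    m ∈ carrier G → M.map α m ∈ carrier H
  smul_mem : ∀ {G H : BisetCat R Z} (a : A.obj G) (m : M.obj H),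
    m ∈ carrier H → M.smul a m ∈ carrier (G.prod H)

/-- An `A`-module is simple if it is nonzero and has no submodules but `0` and itself. -/
def IsSimple (M : GreenModule A) : Prop :=
  (∃ G, Nontrivial (M.obj G)) ∧
    ∀ N : M.Sub, (∀ G, N.carrier G = ⊥) ∨ ∀ G, N.carrier G = ⊤

/-- Isomorphism of `A`-modules: linear isomorphisms `M(G) ≅ N(G)` compatible with the bisets and
with the products with elements of `A`. -/
def IsIso (M N : GreenModule A) : Prop :=
  ∃ e : ∀ G : BisetCat R Z, M.obj G ≃ₗ[R] N.obj G,
    (∀ {G H : BisetCat R Z} (α : RB R H G) (m : M.obj G), e H (M.map α m) = N.map α (e G m)) ∧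
    ∀ {G H : BisetCat R Z} (a : A.obj G) (m : M.obj H),
      e (G.prod H) (M.smul a m) = N.smul a (e H m)

variable (A) in
/-- Isomorphism of simple `A`-modules. -/
instance simpleSetoid : Setoid {S : GreenModule A // S.IsSimple} where
  r S T := IsIso S.1 T.1
  iseqv := by
    refine ⟨fun S => ⟨fun _ => LinearEquiv.refl R _, fun _ _ => rfl, fun _ _ => rfl⟩, ?_, ?_⟩
    · rintro S T ⟨e, h, k⟩
      refine ⟨fun G => (e G).symm, fun α m => ?_, fun a m => ?_⟩
      · rw [LinearEquiv.symm_apply_eq, h, LinearEquiv.apply_symm_apply]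
      · rw [LinearEquiv.symm_apply_eq, k, LinearEquiv.apply_symm_apply]
    · rintro S T U ⟨e, h, k⟩ ⟨e', h', k'⟩
      refine ⟨fun G => (e G).trans (e' G), fun α m => ?_, fun a m => ?_⟩
      · rw [LinearEquiv.trans_apply, h, h']; rfl
      · rw [LinearEquiv.trans_apply, k, k']; rfl

variable (A) in
/-- The isomorphism classes of simple `A`-modules. -/
abbrev SimpleClass := Quotient (simpleSetoid A)

end GreenModule

/-!
A module `M` over `A` is the same as a family of modules `M(G)` with actions
`A(H × G) × M(G) → M(H)` compatible with the composition `∘`: these actions are associative and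
unital (`GreenModule.act_comp`, `GreenModule.act_id`), and they recover the maps `M(U)` of bisets
(`GreenModule.act_ofBiset`) and the products `a × m` (`GreenModule.act_smulElt`). So submodules and
isomorphisms can be tested on the actions alone, and the correspondence is the usual one between
the simple representations of a category and those of the endomorphism algebras of its objects.

If `S` is simple and `S(H) ≠ 0`, every `m ≠ 0` in `S(H)` generates `S`, and an element of `S(G)`
which all of `A(H × G)` sends to `0` is `0`. For `H` minimal, elements factoring through smaller
groups act as `0`, so `S(H)` is a simple `Â(H)`-module (`GreenModule.seed`). It determines `S`:
choosing `m ≠ 0` in `S(H)`, the module `S(G)` is `A(G × H)` modulo the `α` with `(b ∘ α) m = 0`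
for all `b` (`GreenModule.IsSimple.isIso`).

Conversely, for a couple `(H, V)` and `v ≠ 0` in `V`, dividing the module `G ↦ A(G × H)` by the
`α` with `(b ∘ α) v = 0` for all `b` in `A(H × G)` gives a simple module with minimal group `H` and
value `V` at `H` (`GreenModule.ofSeed`, `GreenModule.ofSeed_isSimple`,
`GreenModule.corresponds_ofSeed`).

The couple attached to `S` does not depend on the minimal group up to equivalence, because any two
minimal groups are isomorphic by hypothesis and a group isomorphism `φ : H → G` induces
`S(H) ≅ S(G)` through the element of `A(G × H)` it defines (`GreenModule.isoEquiv`).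
-/

/-! ### Isomorphisms of bisets -/

namespace Biset

variable {L K H G H' G' K' : Type u} [Group L] [Group K] [Group H] [Group G] [Group H'] [Group G']
  [Group K']

theorem comp_prod_comp (V : Biset K H) (U : Biset H G) (V' : Biset K' H') (U' : Biset H' G') :
    IsIso (comp (prod V V') (prod U U')) (prod (comp V U) (comp V' U')) := by
  refine comp_isIso (W := prod (comp V U) (comp V' U'))
    (fun v u => (pair v.1 u.1, pair v.2 u.2)) ?_ ?_ ?_ ?_ ?_
  · intro v h u
    exact Prod.ext (pair_r _ _ _) (pair_r _ _ _)
  · intro k v u; rfl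
  · intro v u g; rfl
  · rintro ⟨v, w⟩ ⟨u, t⟩ ⟨v', w'⟩ ⟨u', t'⟩ e
    obtain ⟨e₁, e₂⟩ := Prod.mk.inj e
    obtain ⟨h, h1, h2⟩ := pair_inj e₁
    obtain ⟨k, k1, k2⟩ := pair_inj e₂
    exact ⟨(h, k), Prod.ext h1 k1, Prod.ext h2 k2⟩
  · rintro ⟨⟨v, u⟩, ⟨v', u'⟩⟩
    exact ⟨(v, v'), (u, u'), rfl⟩

theorem iso_comp [Finite H] {U : Biset H G} {W : Biset K G} (φ : H ≃* K) (e : U.X ≃ W.X)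
    (hl : ∀ h u, e (U.l h u) = W.l (φ h) (e u)) (hr : ∀ u g, e (U.r u g) = W.r (e u) g) :
    IsIso (comp (iso φ) U) W := by
  refine comp_isIso (fun (k : K) u => W.l k (e u)) ?_ ?_ ?_ ?_ ?_
  · intro (v : K) h u
    rw [hl, ← W.mul_l]; rfl
  · intro k (v : K) u
    exact W.mul_l _ _ _
  · intro (v : K) u g
    rw [hr, W.l_r]
  · intro (v : K) u (v' : K) u' h
    refine ⟨φ.symm (v⁻¹ * v'), by simp [iso], e.injective ?_⟩
    rw [hl, map_inv, φ.apply_symm_apply, mul_inv_rev, inv_inv, W.mul_l, h, ← W.mul_l,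
      inv_mul_cancel, W.one_l]
  · intro x
    exact ⟨(1 : K), e.symm x, by rw [W.one_l, e.apply_symm_apply]⟩

theorem prodAssoc_natural [Finite H] [Finite G] [Finite L] [Finite K] [Finite H'] [Finite G']
    (U : Biset H G) (V : Biset H' G') (W : Biset K L) :
    IsIso (comp (prod (prod U V) W)
        (iso (MulEquiv.prodAssoc.symm : G × (G' × L) ≃* (G × G') × L)))
      (comp (iso (MulEquiv.prodAssoc.symm : H × (H' × K) ≃* (H × H') × K))
        (prod U (prod V W))) := by
  let T : Biset ((H × H') × K) (G × (G' × L)) :=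
    { X := (U.X × V.X) × W.X
      finite := (prod (prod U V) W).finite
      l := (prod (prod U V) W).l
      r := fun x g => (prod (prod U V) W).r x ((g.1, g.2.1), g.2.2)
      one_l := (prod (prod U V) W).one_l
      mul_l := (prod (prod U V) W).mul_l
      r_one := (prod (prod U V) W).r_one
      r_mul := fun x g g' => (prod (prod U V) W).r_mul x ((g.1, g.2.1), g.2.2)
        ((g'.1, g'.2.1), g'.2.2)
      l_r := fun h x g => (prod (prod U V) W).l_r h x ((g.1, g.2.1), g.2.2) }
  refine IsIso.trans (V := T) (comp_iso _ (Equiv.refl _) (fun _ _ => rfl) fun _ _ => rfl)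
    (IsIso.symm ?_)
  exact iso_comp (U := prod U (prod V W)) (W := T) _ (Equiv.prodAssoc _ _ _).symm
    (fun _ _ => rfl) fun _ _ => rfl

theorem prod_iso_iso [Finite H] [Finite H'] (φ : H ≃* G) (ψ : H' ≃* G') :
    prod (iso φ) (iso ψ) = iso (φ.prodCongr ψ : H × H' ≃* G × G') := rfl

/-- The pentagon identity for the associativity of direct products. -/
theorem prodAssoc_pentagon [Finite G] [Finite K] [Finite L] [Finite H] :
    IsIso (comp (prod (iso (MulEquiv.prodAssoc.symm : G × (K × L) ≃* (G × K) × L)) (refl H))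
        (comp (iso (MulEquiv.prodAssoc.symm : G × ((K × L) × H) ≃* (G × (K × L)) × H))
          (prod (refl G) (iso (MulEquiv.prodAssoc.symm : K × (L × H) ≃* (K × L) × H)))))
      (comp (iso (MulEquiv.prodAssoc.symm : (G × K) × (L × H) ≃* ((G × K) × L) × H))
        (iso (MulEquiv.prodAssoc.symm : G × (K × (L × H)) ≃* (G × K) × (L × H)))) := by
  change IsIso (comp (prod (iso _) (iso (MulEquiv.refl H)))
    (comp _ (prod (iso (MulEquiv.refl G)) (iso _)))) _
  rw [prod_iso_iso, prod_iso_iso]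
  refine (comp_congr (IsIso.refl _) (iso_comp_iso _ _)).trans ?_
  refine (iso_comp_iso _ _).trans (IsIso.trans ?_ (iso_comp_iso
    (MulEquiv.prodAssoc.symm : (G × K) × (L × H) ≃* ((G × K) × L) × H)
    (MulEquiv.prodAssoc.symm : G × (K × (L × H)) ≃* (G × K) × (L × H))).symm)
  exact ⟨Equiv.refl _, fun _ _ => rfl, fun _ _ => rfl⟩

theorem uniqueProd_prodAssoc [Finite G] [Finite H] :
    IsIso (comp (prod (iso (MulEquiv.uniqueProd : PUnit.{u + 1} × G ≃* G)) (refl H))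
        (iso (MulEquiv.prodAssoc.symm : PUnit.{u + 1} × (G × H) ≃* (PUnit.{u + 1} × G) × H)))
      (iso (MulEquiv.uniqueProd : PUnit.{u + 1} × (G × H) ≃* G × H)) := by
  change IsIso (comp (prod (iso _) (iso (MulEquiv.refl H))) _) _
  rw [prod_iso_iso]
  exact iso_comp_iso _ _

theorem slitAct_prodAssoc [Finite G] [Finite K] [Finite H] :
    IsIso (comp (prod (slitAct G K) (refl H))
        (iso (MulEquiv.prodAssoc.symm : (G × K) × (K × H) ≃* ((G × K) × K) × H)))
      (slit G K H) :=
  comp_iso (V := prod (slitAct G K) (refl H)) (W := slit G K H) _ (Equiv.prodAssoc G K H)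
    (fun _ _ => rfl) fun _ _ => rfl

section slitAct

variable [Finite L] [Finite K] [Finite H] [Finite G]

/-- The biset `H × G⃖ × K⃖`: it contracts the two inner factors `G` and the two factors `K`. -/
def slitAct₂ (H G K : Type u) [Group H] [Group G] [Group K] [Finite H] [Finite G] [Finite K] :
    Biset H (((H × G) × (G × K)) × K) where
  X := H × G × K
  finite := inferInstance
  l h x := (h * x.1, x.2.1, x.2.2)
  r x q := (x.1 * q.1.1.1, q.1.1.2⁻¹ * x.2.1 * q.1.2.1, q.1.2.2⁻¹ * x.2.2 * q.2)
  one_l := by simp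
  mul_l := by simp [mul_assoc]
  r_one := by simp
  r_mul := by simp [mul_assoc]
  l_r := by simp [mul_assoc]

/-- The same biset as `slitAct₂`, with the right action regrouped. -/
def slitAct₂' (H G K : Type u) [Group H] [Group G] [Group K] [Finite H] [Finite G] [Finite K] :
    Biset H ((H × G) × ((G × K) × K)) where
  X := H × G × K
  finite := inferInstance
  l h x := (h * x.1, x.2.1, x.2.2)
  r x q := (x.1 * q.1.1, q.1.2⁻¹ * x.2.1 * q.2.1.1, q.2.1.2⁻¹ * x.2.2 * q.2.2)
  one_l := by simp
  mul_l := by simp [mul_assoc]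
  r_one := by simp
  r_mul := by simp [mul_assoc]
  l_r := by simp [mul_assoc]

theorem slitAct_comp_slit :
    IsIso (comp (slitAct H K) (prod (slit H G K) (refl K))) (slitAct₂ H G K) := by
  refine comp_isIso (W := slitAct₂ H G K)
    (fun (v : H × K) (u : (H × G × K) × K) =>
      (v.1 * u.1.1, u.1.2.1, u.1.2.2⁻¹ * v.2 * u.2)) ?_ ?_ ?_ ?_ ?_
  · rintro ⟨a, b⟩ ⟨⟨d, e⟩, f⟩ ⟨⟨h, i, j⟩, (k : K)⟩
    simp [slitAct, slit, prod, refl, mul_assoc]; rfl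
  · rintro d ⟨a, b⟩ ⟨⟨h, i, j⟩, (k : K)⟩
    simp [slitAct, slitAct₂, mul_assoc]
  · rintro ⟨a, b⟩ ⟨⟨h, i, j⟩, (k : K)⟩ ⟨⟨⟨d, e⟩, ⟨f, g⟩⟩, m⟩
    simp [slit, slitAct₂, prod, refl, mul_assoc]
  · rintro ⟨a, b⟩ ⟨⟨h, i, j⟩, (k : K)⟩ ⟨a', b'⟩ ⟨⟨h', i', j'⟩, (k' : K)⟩ hyp
    obtain ⟨h1, hyp⟩ := Prod.mk.inj hyp
    obtain ⟨rfl, h2⟩ := Prod.mk.inj hyp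
    refine ⟨((h * h'⁻¹, j * j'⁻¹), k * k'⁻¹), ?_, ?_⟩
    · refine Prod.ext ?_ ?_
      · change a' = a * (h * h'⁻¹)
        rw [← mul_assoc, h1]; simp
      · change b' = (j * j'⁻¹)⁻¹ * b * (k * k'⁻¹)
        have : (j * j'⁻¹)⁻¹ * b * (k * k'⁻¹) = j' * (j⁻¹ * b * k) * k'⁻¹ := by group
        rw [this, h2]; group
    · simp [slit, prod, refl]
  · rintro ⟨a, b, c⟩
    exact ⟨(a, c), ((1, b, 1), (1 : K)), by simp; rfl⟩

theorem slitAct_comp_slitAct :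
    IsIso (comp (slitAct H G) (prod (refl (H × G)) (slitAct G K))) (slitAct₂' H G K) := by
  refine comp_isIso (W := slitAct₂' H G K)
    (fun (v : H × G) (u : (H × G) × (G × K)) =>
      (v.1 * u.1.1, u.1.2⁻¹ * v.2 * u.2.1, u.2.2)) ?_ ?_ ?_ ?_ ?_
  · rintro ⟨a, b⟩ ⟨⟨d, e⟩, f⟩ ⟨⟨h, i⟩, j, k⟩
    simp [slitAct, prod, refl, mul_assoc]; rfl
  · rintro d ⟨a, b⟩ ⟨⟨h, i⟩, j, k⟩
    simp [slitAct, slitAct₂', mul_assoc]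
  · rintro ⟨a, b⟩ ⟨⟨h, i⟩, j, k⟩ ⟨⟨d, e⟩, ⟨f, g⟩, m⟩
    simp [slitAct, slitAct₂', prod, refl, mul_assoc]
  · rintro ⟨a, b⟩ ⟨⟨h, i⟩, j, k⟩ ⟨a', b'⟩ ⟨⟨h', i'⟩, j', k'⟩ hyp
    obtain ⟨h1, hyp⟩ := Prod.mk.inj hyp
    obtain ⟨h2, rfl⟩ := Prod.mk.inj hyp
    refine ⟨((h * h'⁻¹, i * i'⁻¹), j * j'⁻¹), ?_, ?_⟩
    · refine Prod.ext ?_ ?_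
      · change a' = a * (h * h'⁻¹)
        rw [← mul_assoc, h1]; simp
      · change b' = (i * i'⁻¹)⁻¹ * b * (j * j'⁻¹)
        have : (i * i'⁻¹)⁻¹ * b * (j * j'⁻¹) = i' * (i⁻¹ * b * j) * j'⁻¹ := by group
        rw [this, h2]; group
    · simp [slitAct, prod, refl]
  · rintro ⟨a, b, c⟩
    exact ⟨(a, b), ((1, 1), (1, c)), by simp; rfl⟩

theorem slitAct_assoc :
    IsIso (comp (comp (slitAct H K) (prod (slit H G K) (refl K)))
        (iso (MulEquiv.prodAssoc.symm : (H × G) × ((G × K) × K) ≃* ((H × G) × (G × K)) × K)))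
      (comp (slitAct H G) (prod (refl (H × G)) (slitAct G K))) :=
  ((comp_congr slitAct_comp_slit (IsIso.refl _)).trans
    (comp_iso (W := slitAct₂' H G K) _ (Equiv.refl _) (fun _ _ => rfl) fun _ _ => rfl)).trans
    slitAct_comp_slitAct.symm

theorem slitAct_toLeft (U : Biset H G) :
    IsIso (comp (slitAct H G) (prod (toLeft U) (refl G)))
      (comp U (iso (MulEquiv.uniqueProd : PUnit.{u + 1} × G ≃* G))) := by
  let W : Biset H (PUnit.{u + 1} × G) :=
    { X := U.X
      finite := U.finite
      l := U.l
      r := fun x g => U.r x g.2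
      one_l := U.one_l
      mul_l := U.mul_l
      r_one := U.r_one
      r_mul := fun x g g' => U.r_mul x g.2 g'.2
      l_r := fun h x g => U.l_r h x g.2 }
  refine IsIso.trans (V := W) ?_
    (comp_iso (V := U) (W := W) _ (Equiv.refl _) (fun _ _ => rfl) fun _ _ => rfl).symm
  refine comp_isIso (W := W)
    (fun (v : H × G) (u : U.X × G) => U.r (U.l v.1 u.1) (v.2 * u.2)) ?_ ?_ ?_ ?_ ?_
  · rintro ⟨a, b⟩ ⟨⟨d, e⟩, f⟩ ⟨(x : U.X), (g : G)⟩
    change U.r (U.l (a * d) x) (e⁻¹ * b * f * g)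
      = U.r (U.l a (U.r (U.l d x) e⁻¹)) (b * (f * g))
    simp only [mul_l, ← l_r, ← r_mul, mul_assoc]
  · rintro d ⟨a, b⟩ ⟨(x : U.X), (g : G)⟩
    change U.r (U.l (d * a) x) (b * g) = U.l d (U.r (U.l a x) (b * g))
    rw [mul_l, l_r]
  · rintro ⟨a, b⟩ ⟨(x : U.X), (g : G)⟩ ⟨⟨⟩, f⟩
    change U.r (U.l a x) (b * (g * f)) = U.r (U.r (U.l a x) (b * g)) f
    rw [← r_mul, mul_assoc]
  · rintro ⟨a, b⟩ ⟨(x : U.X), (g : G)⟩ ⟨a', b'⟩ ⟨(x' : U.X), (g' : G)⟩ hyp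
    change U.r (U.l a x) (b * g) = U.r (U.l a' x') (b' * g') at hyp
    refine ⟨((a⁻¹ * a', b * (g * g'⁻¹) * b'⁻¹), g * g'⁻¹), ?_, ?_⟩
    · refine Prod.ext ?_ ?_
      · change a' = a * (a⁻¹ * a')
        simp
      · change b' = (b * (g * g'⁻¹) * b'⁻¹)⁻¹ * b * (g * g'⁻¹)
        group
    · refine Prod.ext ?_ ?_
      · change x' = U.r (U.l (a⁻¹ * a')⁻¹ x) ((b * (g * g'⁻¹) * b'⁻¹)⁻¹)⁻¹
        have := congrArg (fun z => U.l a'⁻¹ (U.r z (b' * g')⁻¹)) hyp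
        simp only [← r_mul, ← l_r, ← mul_l, mul_inv_cancel, inv_mul_cancel, r_one, one_l] at this
        rw [← this]
        congr 1
        · group
        · group
      · change g' = (g * g'⁻¹)⁻¹ * g
        group
  · intro x
    exact ⟨(1, 1), (x, (1 : G)), by simp [one_l]; exact U.r_one x⟩

/-- The biset `H × G⃖ × K`, which turns elements of `A(H × (G × K))` and `A(G)` into an element of
`A(H × K)`. -/
def slitIn (H G K : Type u) [Group H] [Group G] [Group K] [Finite H] [Finite G] [Finite K] :
    Biset (H × K) ((H × (G × K)) × G) where
  X := H × G × K
  finite := inferInstance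
  l p x := (p.1 * x.1, x.2.1, p.2 * x.2.2)
  r x q := (x.1 * q.1.1, q.1.2.1⁻¹ * x.2.1 * q.2, x.2.2 * q.1.2.2)
  one_l := by simp
  mul_l := by simp [mul_assoc]
  r_one := by simp
  r_mul := by simp [mul_assoc]
  l_r := by simp [mul_assoc]

/-- The biset `slitAct H (G × K)`, with the right action regrouped. -/
def slitActProd (H G K : Type u) [Group H] [Group G] [Group K] [Finite H] [Finite G] [Finite K] :
    Biset H (((H × (G × K)) × G) × K) where
  X := H × G × K
  finite := inferInstance
  l h x := (h * x.1, x.2.1, x.2.2)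
  r x q := (x.1 * q.1.1.1, q.1.1.2.1⁻¹ * x.2.1 * q.1.2, q.1.1.2.2⁻¹ * x.2.2 * q.2)
  one_l := by simp
  mul_l := by simp [mul_assoc]
  r_one := by simp
  r_mul := by simp [mul_assoc]
  l_r := by simp [mul_assoc]

theorem slitAct_comp_slitIn :
    IsIso (comp (slitAct H K) (prod (slitIn H G K) (refl K))) (slitActProd H G K) := by
  refine comp_isIso (W := slitActProd H G K)
    (fun (v : H × K) (u : (H × G × K) × K) =>
      (v.1 * u.1.1, u.1.2.1, u.1.2.2⁻¹ * v.2 * u.2)) ?_ ?_ ?_ ?_ ?_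
  · rintro ⟨a, b⟩ ⟨⟨d, e⟩, f⟩ ⟨⟨h, i, j⟩, (k : K)⟩
    simp [slitAct, slitIn, prod, refl, mul_assoc]; rfl
  · rintro d ⟨a, b⟩ ⟨⟨h, i, j⟩, (k : K)⟩
    simp [slitAct, slitActProd, mul_assoc]
  · rintro ⟨a, b⟩ ⟨⟨h, i, j⟩, (k : K)⟩ ⟨⟨⟨d, e, f⟩, g⟩, m⟩
    simp [slitIn, slitActProd, prod, refl, mul_assoc]
  · rintro ⟨a, b⟩ ⟨⟨h, i, j⟩, (k : K)⟩ ⟨a', b'⟩ ⟨⟨h', i', j'⟩, (k' : K)⟩ hyp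
    obtain ⟨h1, hyp⟩ := Prod.mk.inj hyp
    obtain ⟨rfl, h2⟩ := Prod.mk.inj hyp
    refine ⟨((h * h'⁻¹, j * j'⁻¹), k * k'⁻¹), ?_, ?_⟩
    · refine Prod.ext ?_ ?_
      · change a' = a * (h * h'⁻¹)
        rw [← mul_assoc, h1]; simp
      · change b' = (j * j'⁻¹)⁻¹ * b * (k * k'⁻¹)
        have : (j * j'⁻¹)⁻¹ * b * (k * k'⁻¹) = j' * (j⁻¹ * b * k) * k'⁻¹ := by group
        rw [this, h2]; group
    · simp [slitIn, prod, refl]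
  · rintro ⟨a, b, c⟩
    exact ⟨(a, c), ((1, b, 1), (1 : K)), by simp; rfl⟩

theorem slitIn_prodAssoc :
    IsIso (comp (comp (slitAct H K) (prod (slitIn H G K) (refl K)))
        (iso (MulEquiv.prodAssoc.symm : (H × (G × K)) × (G × K) ≃* ((H × (G × K)) × G) × K)))
      (slitAct H (G × K)) :=
  (comp_congr slitAct_comp_slitIn (IsIso.refl _)).trans
    (comp_iso (W := slitAct H (G × K)) _ (Equiv.refl _) (fun _ _ => rfl) fun _ _ => rfl)

end slitAct

end Biset

/-! ### Composition and products in `RB` -/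

namespace RB

variable {R : Type r} [CommRing R]
variable {L K H G H' G' K' L' : Type u} [Group L] [Group K] [Group H] [Group G] [Group H']
  [Group G'] [Group K'] [Group L']

theorem comp_prod_comp (v : RB R K H) (u : RB R H G) (v' : RB R K' H') (u' : RB R H' G') :
    comp (prod v v') (prod u u') = prod (comp v u) (comp v' u') := by
  refine LinearMap.congr_fun (f := comp.flip (prod u u') ∘ₗ prod.flip v')
    (g := prod.flip (comp v' u') ∘ₗ comp.flip u) (hom_ext fun V => ?_) v
  refine LinearMap.congr_fun (f := comp.flip (prod u u') ∘ₗ prod (of R V))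
    (g := prod (comp (of R V) u) ∘ₗ comp.flip u') (hom_ext fun V' => ?_) v'
  refine LinearMap.congr_fun (f := comp (prod (of R V) (of R V')) ∘ₗ prod.flip u')
    (g := prod.flip (comp (of R V') u') ∘ₗ comp (of R V)) (hom_ext fun U => ?_) u
  refine LinearMap.congr_fun (f := comp (prod (of R V) (of R V')) ∘ₗ prod (of R U))
    (g := prod (comp (of R V) (of R U)) ∘ₗ comp (of R V')) (hom_ext fun U' => ?_) u'
  simp only [LinearMap.comp_apply]
  rw [prod_of, prod_of, comp_of, comp_of, comp_of, prod_of,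
    of_eq (Biset.comp_prod_comp V U V' U')]

theorem prodAssoc_natural [Finite H] [Finite G] [Finite L] [Finite K] [Finite H'] [Finite G']
    (u : RB R H G) (v : RB R H' G') (w : RB R K L) :
    comp (prod (prod u v) w)
        (of R (Biset.iso (MulEquiv.prodAssoc.symm : G × (G' × L) ≃* (G × G') × L)))
      = comp (of R (Biset.iso (MulEquiv.prodAssoc.symm : H × (H' × K) ≃* (H × H') × K)))
        (prod u (prod v w)) := by
  set x := of R (Biset.iso (MulEquiv.prodAssoc.symm : G × (G' × L) ≃* (G × G') × L)) with hx
  set y := of R (Biset.iso (MulEquiv.prodAssoc.symm : H × (H' × K) ≃* (H × H') × K)) with hy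
  refine LinearMap.congr_fun (f := comp.flip x ∘ₗ prod.flip w ∘ₗ prod.flip v)
    (g := comp y ∘ₗ prod.flip (prod v w)) (hom_ext fun U => ?_) u
  refine LinearMap.congr_fun (f := comp.flip x ∘ₗ prod.flip w ∘ₗ prod (of R U))
    (g := comp y ∘ₗ prod (of R U) ∘ₗ prod.flip w) (hom_ext fun V => ?_) v
  refine LinearMap.congr_fun (f := comp.flip x ∘ₗ prod (prod (of R U) (of R V)))
    (g := comp y ∘ₗ prod (of R U) ∘ₗ prod (of R V)) (hom_ext fun W => ?_) w
  simp only [LinearMap.comp_apply, LinearMap.flip_apply]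
  rw [prod_of, prod_of, prod_of, prod_of, hx, hy, comp_of, comp_of,
    of_eq (Biset.prodAssoc_natural U V W)]

end RB

/-! ### Elementary properties of biset functors and of modules -/

namespace BisetFunctor

variable {R : Type r} [CommRing R] {Z : GroupClass.{u}}

/-- `M.map` as a linear map in the morphism. -/
noncomputable def mapₗ (M : BisetFunctor.{u, r, w} R Z) (G H : BisetCat R Z) :
    RB R H G →ₗ[R] M.obj G →ₗ[R] M.obj H where
  toFun α := M.map α
  map_add' α β := by
    have := M.additive
    exact congrArg ModuleCat.Hom.hom
      (M.toFunctor.map_add (f := BisetCat.hom α) (g := BisetCat.hom β))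
  map_smul' c α := by
    have := M.linear
    exact congrArg ModuleCat.Hom.hom (M.toFunctor.map_smul c (BisetCat.hom α))

/-- A biset functor from its values, its linear maps, and the two functor laws. -/
noncomputable def ofData (obj : BisetCat R Z → Type w) [∀ G, AddCommGroup (obj G)]
    [∀ G, Module R (obj G)] (map : ∀ G H : BisetCat R Z, RB R H G →ₗ[R] obj G →ₗ[R] obj H)
    (map_refl : ∀ G x, map G G (RB.of R (Biset.refl G)) x = x)
    (map_map : ∀ (G H K : BisetCat R Z) (β : RB R K H) (α : RB R H G) x,
      map H K β (map G H α x) = map G K (RB.comp β α) x) : BisetFunctor.{u, r, w} R Z where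
  toFunctor :=
    { obj := fun G => ModuleCat.of R (obj G)
      map := fun {G H} α => ModuleCat.ofHom (map G H α)
      map_id := fun G => by
        ext x
        exact map_refl G x
      map_comp := fun {G H K} α β => by
        ext x
        exact (map_map G H K β α x).symm }
  additive := ⟨fun {G H} {α β} => by
    ext x
    exact LinearMap.congr_fun (map_add (map G H) α β) x⟩
  linear := ⟨fun {G H} α c => by
    ext x
    exact LinearMap.congr_fun (_root_.map_smul (map G H) c α) x⟩

end BisetFunctor

namespace GreenModule

variable {R : Type r} [CommRing R] {Z : GroupClass.{u}} {A : GreenBisetFunctor.{u, r, w} R Z}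

theorem act_map (M : GreenModule A) {G K X Y : BisetCat R Z} (φ : RB R (G × K) X) (ψ : RB R K Y)
    (a : A.obj X) (m : M.obj Y) :
    M.act (A.map (H := G.prod K) φ a) (M.map (H := K) ψ m)
      = M.map (G := X.prod Y) (H := G)
        (RB.comp (RB.of R (Biset.slitAct G K)) (RB.prod φ ψ)) (M.smul a m) :=
  (congrArg (M.map (G := (G.prod K).prod K) (H := G) (RB.of R (Biset.slitAct G K)))
    (M.map_smul (G := X) (G' := G.prod K) (H := Y) (H' := K) φ ψ a m).symm).trans
    (M.map_map (G := X.prod Y) (H := (G.prod K).prod K) (K := G) _ _ _)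

theorem act_comp (M : GreenModule A) {H G K : BisetCat R Z} (β : A.obj (H.prod G))
    (α : A.obj (G.prod K)) (m : M.obj K) : M.act (A.comp β α) m = M.act β (M.act α m) := by
  have h1 := M.act_map (RB.of R (Biset.slit H G K)) (RB.of R (Biset.refl K))
    (X := (H.prod G).prod (G.prod K)) (Y := K) (A.mul β α) m
  have h2 := M.act_map (RB.of R (Biset.refl (H × G))) (RB.of R (Biset.slitAct G K))
    (X := H.prod G) (Y := (G.prod K).prod K) β (M.smul α m)
  have e1 := M.map_refl (G := K) m
  have e2 := A.map_refl (G := H.prod G) β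
  rw [RB.prod_of, RB.comp_of] at h1 h2
  refine (congrArg (M.act (A.comp β α)) e1.symm).trans (h1.trans ?_)
  refine Eq.trans ?_ (h2.symm.trans (congrArg (fun x => M.act x (M.act α m)) e2))
  refine (congrArg _ (M.mul_smul β α m)).trans ?_
  refine (M.map_map (G := (H.prod G).prod ((G.prod K).prod K)) (K := H) _ _ _).trans ?_
  rw [RB.comp_of, RB.of_eq Biset.slitAct_assoc]

/-- The map given by a biset `U` is the action of the element of `A` associated with `U`. -/
theorem act_ofBiset (M : GreenModule A) {H G : BisetCat R Z} (U : Biset H G) (m : M.obj G) :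
    M.act (A.ofBiset U) m = M.map (RB.of R U) m := by
  have h1 := M.act_map (RB.of R U.toLeft) (RB.of R (Biset.refl G))
    (X := BisetCat.unit) (Y := G) A.ε m
  have e1 := M.map_refl (G := G) m
  rw [RB.prod_of, RB.comp_of, RB.of_eq (Biset.slitAct_toLeft U), ← RB.comp_of] at h1
  refine (congrArg (M.act (A.ofBiset U)) e1.symm).trans (h1.trans ?_)
  exact (M.map_map (G := BisetCat.unit.prod G) (H := G) (K := H) _ _ _).symm.trans
    (congrArg (M.map (RB.of R U)) (M.one_smul m))

theorem act_id (M : GreenModule A) {H : BisetCat R Z} (m : M.obj H) : M.act (A.id H) m = m :=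
  (M.act_ofBiset (Biset.refl H) m).trans (M.map_refl m)

/-- The biset `slitIn` absorbs a product with `a` into the acting element. -/
theorem act_smul (M : GreenModule A) {H G K : BisetCat R Z} (b : A.obj (H.prod (G.prod K)))
    (a : A.obj G) (m : M.obj K) :
    M.act (G := H) (H := G.prod K) b (M.smul a m) = M.act (G := H) (H := K)
      (A.map (G := (H.prod (G.prod K)).prod G) (H := H.prod K)
        (RB.of R (Biset.slitIn H G K)) (A.mul b a)) m := by
  have h1 := M.act_map (RB.of R (Biset.slitIn H G K)) (RB.of R (Biset.refl K))
    (X := (H.prod (G.prod K)).prod G) (Y := K) (A.mul b a) m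
  have e1 := M.map_refl (G := K) m
  rw [RB.prod_of, RB.comp_of] at h1
  refine Eq.trans ?_ (h1.symm.trans (congrArg _ e1))
  refine Eq.trans ?_ (congrArg _ (M.mul_smul b a m)).symm
  refine Eq.trans ?_
    (M.map_map (G := (H.prod (G.prod K)).prod (G.prod K)) (K := H) _ _ _).symm
  rw [RB.comp_of, RB.of_eq Biset.slitIn_prodAssoc]
  rfl

variable (A) in
/-- The element of `A((G × K) × K)` whose action is the product with `a`. -/
noncomputable def smulElt {G : BisetCat R Z} (K : BisetCat R Z) (a : A.obj G) :
    A.obj ((G.prod K).prod K) :=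
  A.map (G := ((G.prod K).prod (G.prod K)).prod G) (H := (G.prod K).prod K)
    (RB.of R (Biset.slitIn (G × K) G K)) (A.mul (A.id (G.prod K)) a)

theorem act_smulElt (M : GreenModule A) {G K : BisetCat R Z} (a : A.obj G) (m : M.obj K) :
    M.act (smulElt A K a) m = M.smul a m :=
  (M.act_smul (H := G.prod K) (A.id (G.prod K)) a m).symm.trans (M.act_id (M.smul a m))

/-- A family of submodules stable under the actions of the `A(H × G)` is a submodule. -/
def Sub.ofAct (M : GreenModule A) (N : ∀ G : BisetCat R Z, Submodule R (M.obj G))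
    (h : ∀ {G H : BisetCat R Z} (a : A.obj (H.prod G)) (m : M.obj G), m ∈ N G → M.act a m ∈ N H) :
    M.Sub where
  carrier := N
  map_mem {G H} α m hm := by
    -- Bisets span `RB(H, G)`, so it is enough to test the maps `M(U)`.
    let f : RB R H G →ₗ[R] M.obj H ⧸ N H := (N H).mkQ ∘ₗ (M.mapₗ G H).flip m
    have hf : f = 0 := RB.hom_ext fun U =>
      (Submodule.Quotient.mk_eq_zero _).2 (M.act_ofBiset U m ▸ h _ m hm)
    exact (Submodule.Quotient.mk_eq_zero _).1 (LinearMap.congr_fun hf α)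
  smul_mem a m hm := M.act_smulElt a m ▸ h _ m hm

theorem Sub.act_mem {M : GreenModule A} (N : M.Sub) {G H : BisetCat R Z} (a : A.obj (H.prod G))
    {m : M.obj G} (hm : m ∈ N.carrier G) : M.act a m ∈ N.carrier H :=
  N.map_mem (G := (H.prod G).prod G) _ _ (N.smul_mem a m hm)

/-- Linear isomorphisms compatible with the actions are isomorphisms of `A`-modules. -/
theorem isIso_of_act {M N : GreenModule A} (e : ∀ G : BisetCat R Z, M.obj G ≃ₗ[R] N.obj G)
    (h : ∀ {G H : BisetCat R Z} (a : A.obj (H.prod G)) (m : M.obj G),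
      e H (M.act a m) = N.act a (e G m)) : IsIso M N := by
  refine ⟨e, fun {G H} α m => ?_, fun {G H} a m => ?_⟩
  · refine LinearMap.congr_fun (f := (e H).toLinearMap ∘ₗ (M.mapₗ G H).flip m)
      (g := (N.mapₗ G H).flip (e G m)) (RB.hom_ext fun U => ?_) α
    exact (congrArg (e H) (M.act_ofBiset U m).symm).trans ((h _ m).trans (N.act_ofBiset U _))
  · exact (congrArg (e (G.prod H)) (M.act_smulElt a m).symm).trans
      ((h _ m).trans (N.act_smulElt a _))

theorem IsIso.act {M N : GreenModule A} (e : ∀ G : BisetCat R Z, M.obj G ≃ₗ[R] N.obj G)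
    (h : ∀ {G H : BisetCat R Z} (α : RB R H G) (m : M.obj G), e H (M.map α m) = N.map α (e G m))
    (h' : ∀ {G H : BisetCat R Z} (a : A.obj G) (m : M.obj H),
      e (G.prod H) (M.smul a m) = N.smul a (e H m))
    {G H : BisetCat R Z} (a : A.obj (H.prod G)) (m : M.obj G) :
    e H (M.act a m) = N.act a (e G m) :=
  (h (G := (H.prod G).prod G) _ _).trans (congrArg _ (h' a m))

/-! ### Quotients and shifts -/

/-- The biset functor underlying the quotient of an `A`-module by a submodule. -/
noncomputable def quotFunctor (M : GreenModule A) (N : M.Sub) : BisetFunctor.{u, r, w} R Z :=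
  BisetFunctor.ofData (fun G => M.obj G ⧸ N.carrier G)
    (fun G H =>
      { toFun := fun α => (N.carrier G).mapQ (N.carrier H) (M.map α) fun m hm => N.map_mem α m hm
        map_add' := fun α β => Submodule.linearMap_qext _ <| LinearMap.ext fun m =>
          congrArg (N.carrier H).mkQ (LinearMap.congr_fun (map_add (M.mapₗ G H) α β) m)
        map_smul' := fun c α => Submodule.linearMap_qext _ <| LinearMap.ext fun m =>
          congrArg (N.carrier H).mkQ
            (LinearMap.congr_fun (_root_.map_smul (M.mapₗ G H) c α) m) })
    (fun G x => by
      obtain ⟨x, rfl⟩ := Submodule.Quotient.mk_surjective _ x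
      exact congrArg (N.carrier G).mkQ (M.map_refl x))
    (fun G H K β α x => by
      obtain ⟨x, rfl⟩ := Submodule.Quotient.mk_surjective _ x
      exact congrArg (N.carrier K).mkQ (M.map_map β α x))

/-- The product of `A` on the quotient of an `A`-module by a submodule. -/
noncomputable def quotSMul (M : GreenModule A) (N : M.Sub) (G H : BisetCat R Z) :
    A.obj G →ₗ[R] (M.quotFunctor N).obj H →ₗ[R] (M.quotFunctor N).obj (G.prod H) where
  toFun a := (N.carrier H).mapQ (N.carrier (G.prod H)) (M.smul a) fun m hm => N.smul_mem a m hm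
  map_add' a b := Submodule.linearMap_qext _ <| LinearMap.ext fun m : M.obj H =>
    congrArg (N.carrier (G.prod H)).mkQ (LinearMap.congr_fun (map_add M.smul a b) m)
  map_smul' c a := Submodule.linearMap_qext _ <| LinearMap.ext fun m : M.obj H =>
    congrArg (N.carrier (G.prod H)).mkQ (LinearMap.congr_fun (_root_.map_smul M.smul c a) m)

/-- The quotient of an `A`-module by a submodule. -/
noncomputable def quot (M : GreenModule A) (N : M.Sub) : GreenModule A where
  toBisetFunctor := M.quotFunctor N
  smul {G H} := M.quotSMul N G H
  mul_smul {G H K} a b x := by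
    obtain ⟨x, rfl⟩ := (N.carrier K).mkQ_surjective x
    exact congrArg (N.carrier ((G.prod H).prod K)).mkQ (M.mul_smul a b x)
  one_smul {G} x := by
    obtain ⟨x, rfl⟩ := (N.carrier G).mkQ_surjective x
    exact congrArg (N.carrier G).mkQ (M.one_smul x)
  map_smul {G G' H H'} φ ψ a x := by
    obtain ⟨x, rfl⟩ := (N.carrier H).mkQ_surjective x
    exact congrArg (N.carrier (G'.prod H')).mkQ (M.map_smul φ ψ a x)

/-- The projection of an `A`-module on a quotient. -/
noncomputable def proj (M : GreenModule A) (N : M.Sub) (G : BisetCat R Z) :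
    M.obj G →ₗ[R] (M.quot N).obj G := (N.carrier G).mkQ

theorem proj_surjective (M : GreenModule A) (N : M.Sub) (G : BisetCat R Z) :
    Function.Surjective (M.proj N G) := (N.carrier G).mkQ_surjective

theorem proj_eq_zero (M : GreenModule A) (N : M.Sub) {G : BisetCat R Z} {m : M.obj G} :
    M.proj N G m = 0 ↔ m ∈ N.carrier G := Submodule.Quotient.mk_eq_zero _

theorem shift_mul_smul {G K L H : BisetCat R Z} (a : A.obj G) (b : A.obj K)
    (x : A.obj (L.prod H)) :
    A.map (G := (G.prod K).prod (L.prod H)) (H := ((G.prod K).prod L).prod H)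
        (RB.of R (Biset.iso MulEquiv.prodAssoc.symm)) (A.mul (A.mul a b) x)
      = A.map (G := (G.prod (K.prod L)).prod H) (H := ((G.prod K).prod L).prod H)
        (RB.prod (RB.of R (Biset.iso MulEquiv.prodAssoc.symm)) (RB.of R (Biset.refl H)))
        (A.map (G := G.prod ((K.prod L).prod H)) (H := (G.prod (K.prod L)).prod H)
          (RB.of R (Biset.iso MulEquiv.prodAssoc.symm))
          (A.mul a (A.map (G := K.prod (L.prod H)) (H := (K.prod L).prod H)
            (RB.of R (Biset.iso MulEquiv.prodAssoc.symm)) (A.mul b x)))) := by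
  have h := A.map_mul (G := G) (G' := G) (H := K.prod (L.prod H)) (H' := (K.prod L).prod H)
    (RB.of R (Biset.refl G)) (RB.of R (Biset.iso MulEquiv.prodAssoc.symm)) a (A.mul b x)
  rw [A.map_refl (G := G) a] at h
  rw [← h, A.mul_assoc]
  refine (A.map_map (G := G.prod (K.prod (L.prod H))) (H := (G.prod K).prod (L.prod H))
    (K := ((G.prod K).prod L).prod H) _ _ _).trans (Eq.symm ?_)
  refine (congrArg _ (A.map_map (G := G.prod (K.prod (L.prod H)))
    (H := G.prod ((K.prod L).prod H)) (K := (G.prod (K.prod L)).prod H) _ _ _)).trans ?_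
  refine (A.map_map (G := G.prod (K.prod (L.prod H))) (H := (G.prod (K.prod L)).prod H)
    (K := ((G.prod K).prod L).prod H) _ _ _).trans ?_
  rw [RB.prod_of, RB.prod_of, RB.comp_of, RB.comp_of, RB.comp_of,
    RB.of_eq Biset.prodAssoc_pentagon]

theorem shift_one_smul {G H : BisetCat R Z} (x : A.obj (G.prod H)) :
    A.map (G := (BisetCat.unit.prod G).prod H) (H := G.prod H)
      (RB.prod (RB.of R (Biset.iso MulEquiv.uniqueProd)) (RB.of R (Biset.refl H)))
      (A.map (G := BisetCat.unit.prod (G.prod H)) (H := (BisetCat.unit.prod G).prod H)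
        (RB.of R (Biset.iso MulEquiv.prodAssoc.symm)) (A.mul A.ε x)) = x := by
  refine (A.map_map (G := BisetCat.unit.prod (G.prod H)) (H := (BisetCat.unit.prod G).prod H)
    (K := G.prod H) _ _ _).trans ?_
  refine Eq.trans ?_ (A.one_mul (G := G.prod H) x)
  rw [RB.prod_of, RB.comp_of, RB.of_eq Biset.uniqueProd_prodAssoc]

theorem shift_map_smul {G G' K K' H : BisetCat R Z} (φ : RB R G' G) (ψ : RB R K' K)
    (a : A.obj G) (x : A.obj (K.prod H)) :
    A.map (G := (G.prod K).prod H) (H := (G'.prod K').prod H)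
        (RB.prod (RB.prod φ ψ) (RB.of R (Biset.refl H)))
        (A.map (G := G.prod (K.prod H)) (H := (G.prod K).prod H)
          (RB.of R (Biset.iso MulEquiv.prodAssoc.symm)) (A.mul a x))
      = A.map (G := G'.prod (K'.prod H)) (H := (G'.prod K').prod H)
        (RB.of R (Biset.iso MulEquiv.prodAssoc.symm))
        (A.mul (A.map φ a) (A.map (G := K.prod H) (H := K'.prod H)
          (RB.prod ψ (RB.of R (Biset.refl H))) x)) := by
  refine (A.map_map (G := G.prod (K.prod H)) (H := (G.prod K).prod H)
    (K := (G'.prod K').prod H) _ _ _).trans ?_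
  refine Eq.trans ?_ (congrArg (A.map (G := G'.prod (K'.prod H)) (H := (G'.prod K').prod H)
    (RB.of R (Biset.iso MulEquiv.prodAssoc.symm))) (A.map_mul (G := G) (G' := G')
      (H := K.prod H) (H' := K'.prod H) φ (RB.prod ψ (RB.of R (Biset.refl H))) a x))
  refine Eq.trans ?_ (A.map_map (G := G.prod (K.prod H)) (H := G'.prod (K'.prod H))
    (K := (G'.prod K').prod H) _ _ _).symm
  rw [RB.prodAssoc_natural]

variable (A) in
/-- The shift of `A` by `H`: the `A`-module `G ↦ A(G × H)`. -/
noncomputable def shift (H : BisetCat R Z) : GreenModule A where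
  toBisetFunctor := BisetFunctor.ofData (fun G => A.obj (G.prod H))
    (fun G K => A.mapₗ (G.prod H) (K.prod H) ∘ₗ RB.prod.flip (RB.of R (Biset.refl H)))
    (fun G x => by
      refine Eq.trans ?_ (A.map_refl (G := G.prod H) x)
      exact congrArg (fun y => A.map (G := G.prod H) (H := G.prod H) y x) (RB.prod_of _ _))
    (fun G K L β α x => by
      refine (A.map_map (G := G.prod H) (H := K.prod H) (K := L.prod H) _ _ x).trans ?_
      refine congrArg (fun y => A.map (G := G.prod H) (H := L.prod H) y x) ?_
      exact (RB.comp_prod_comp _ _ _ _).trans (congrArg (RB.prod _) (RB.refl_comp _)))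
  smul {G K} := A.mul.compr₂ (A.map (G := G.prod (K.prod H)) (H := (G.prod K).prod H)
    (RB.of R (Biset.iso (MulEquiv.prodAssoc.symm : G × (K × H) ≃* (G × K) × H))))
  mul_smul {G K L} a b x := shift_mul_smul a b x
  one_smul {G} x := shift_one_smul x
  map_smul {G G' K K'} φ ψ a x := shift_map_smul φ ψ a x

/-- On the shift `G ↦ A(G × H)`, the action is the composition. -/
theorem shift_act {H G K : BisetCat R Z} (b : A.obj (G.prod K)) (a : A.obj (K.prod H)) :
    (shift A H).act (G := G) (H := K) b a = A.comp b a := by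
  refine (A.map_map (G := (G.prod K).prod (K.prod H)) (H := ((G.prod K).prod K).prod H)
      (K := G.prod H) _ _ _).trans ?_
  refine congrArg (fun y => A.map (G := (G.prod K).prod (K.prod H)) (H := G.prod H) y
      (A.mul b a)) ?_
  refine (congrArg (fun y => RB.comp y _) (RB.prod_of _ _)).trans ?_
  exact (RB.comp_of _ _).trans (RB.of_eq Biset.slitAct_prodAssoc)

end GreenModule

/-! ### Simple modules and their minimal groups -/

namespace GreenModule

variable {R : Type r} [CommRing R] {Z : GroupClass.{u}} {A : GreenBisetFunctor.{u, r, w} R Z}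

/-- An element `m ≠ 0` of a simple module generates it: the `A(G × H) m` form a submodule. -/
theorem IsSimple.exists_act_eq {S : GreenModule A} (hS : S.IsSimple) {H : BisetCat R Z}
    {m : S.obj H} (hm : m ≠ 0) {G : BisetCat R Z} (x : S.obj G) :
    ∃ a : A.obj (G.prod H), S.act a m = x := by
  let N : S.Sub := Sub.ofAct S (fun G => LinearMap.range (S.act.flip m : A.obj (G.prod H) →ₗ[R] _))
    (by rintro G K b _ ⟨a, rfl⟩; exact ⟨A.comp b a, S.act_comp b a m⟩)
  rcases hS.2 N with h | h
  · exact absurd ((Submodule.mem_bot R).1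
      (h H ▸ (⟨A.id H, S.act_id m⟩ : m ∈ N.carrier H))) hm
  · exact (h G ▸ Submodule.mem_top : x ∈ N.carrier G)

/-- The elements of a simple module `S` that all of `A(H × G)` sends to `0` in `S(H)` form a
submodule, which vanishes if `S(H) ≠ 0`. -/
theorem IsSimple.eq_zero_of_act {S : GreenModule A} (hS : S.IsSimple) {H : BisetCat R Z}
    (hH : Nontrivial (S.obj H)) {G : BisetCat R Z} {x : S.obj G}
    (hx : ∀ b : A.obj (H.prod G), S.act b x = 0) : x = 0 := by
  let N : S.Sub := Sub.ofAct S (fun G => ⨅ b : A.obj (H.prod G), LinearMap.ker (S.act b)) (by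
    intro G K a m hm
    rw [Submodule.mem_iInf] at hm ⊢
    exact fun b => (S.act_comp b a m).symm.trans (hm (A.comp b a)))
  rcases hS.2 N with h | h
  · exact (Submodule.mem_bot R).1 (h G ▸ ((Submodule.mem_iInf _).2 hx : x ∈ N.carrier G))
  · obtain ⟨m, hm⟩ := exists_ne (0 : S.obj H)
    have : m ∈ N.carrier H := h H ▸ Submodule.mem_top
    exact absurd ((S.act_id m).symm.trans ((Submodule.mem_iInf _).1 this (A.id H))) hm

theorem act_eq_zero_of_mem_I {M : GreenModule A} {H : BisetCat R Z} (hH : M.IsMinimal H)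
    {a : A.EndAlg H} (ha : a ∈ A.I H) (m : M.obj H) :
    M.act (G := H) (H := H) a m = 0 := by
  have h : A.I H ≤ LinearMap.ker (M.act.flip m : A.obj (H.prod H) →ₗ[R] M.obj H) := by
    refine Submodule.span_le.2 ?_
    rintro _ ⟨K, b, c, hK, rfl⟩
    have := hH.2 K hK
    refine (M.act_comp b c m).trans ?_
    rw [Subsingleton.elim (M.act c m) 0, map_zero]
  exact h ha

/-- The action of the algebra `A(H × H)` on `M(H)`. -/
noncomputable def actHom (M : GreenModule A) (H : BisetCat R Z) :
    A.EndAlg H →+* AddMonoid.End (M.obj H) where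
  toFun a := (M.act (G := H) (H := H) a).toAddMonoidHom
  map_one' := AddMonoidHom.ext fun m => M.act_id m
  map_mul' a b := AddMonoidHom.ext fun m => M.act_comp (H := H) (G := H) (K := H) a b m
  map_zero' := AddMonoidHom.ext fun m =>
    LinearMap.congr_fun (map_zero (M.act (G := H) (H := H))) m
  map_add' a b := AddMonoidHom.ext fun m =>
    LinearMap.congr_fun (map_add (M.act (G := H) (H := H)) a b) m

/-- The `Â(H)`-module structure of `M(H)` for a minimal group `H` of `M`. -/
noncomputable abbrev hatModule {M : GreenModule A} {H : BisetCat R Z} (hH : M.IsMinimal H) :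
    Module (A.Hat H) (M.obj H) :=
  Module.compHom (M.obj H) (Ideal.Quotient.lift (A.ideal H) (M.actHom H)
    fun _ ha => AddMonoidHom.ext fun m => act_eq_zero_of_mem_I hH ha m)

/-- The couple `(H, S(H))` of a simple module `S` and a minimal group `H` of `S`. -/
noncomputable def seed {S : GreenModule A} (hS : S.IsSimple) {H : BisetCat R Z}
    (hH : S.IsMinimal H) : A.Seed :=
  letI := hatModule hH
  have := hH.1
  { H := H
    V := S.obj H
    nontrivial := Module.nontrivial (A.Hat H) (S.obj H)
    simple := isSimpleModule_iff_toSpanSingleton_surjective.2 ⟨hH.1, fun m hm x => by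
      obtain ⟨a, rfl⟩ := hS.exists_act_eq hm x
      exact ⟨GreenBisetFunctor.toHat a, rfl⟩⟩ }

theorem IsSimple.exists_isMinimal {S : GreenModule A} (hS : S.IsSimple) :
    ∃ H, S.IsMinimal H := by
  have hne : {H : BisetCat R Z | Nontrivial (S.obj H)}.Nonempty := hS.1
  refine ⟨Function.argminOn (fun H : BisetCat R Z => Nat.card H) _ hne,
    Function.argminOn_mem _ _ hne, fun K hK => ?_⟩
  by_contra h
  exact Function.not_lt_argminOn (fun H : BisetCat R Z => Nat.card H) _
    (not_subsingleton_iff_nontrivial.1 h) hK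

/-! ### The correspondence between simple modules and couples -/

/-- A module `S` corresponds to the couple `(H, V)`: the group `H` is minimal for `S`, and
`V ≅ S(H)` as `A(H × H)`-modules. -/
def Corresponds (S : GreenModule A) (P : A.Seed) : Prop :=
  S.IsMinimal P.H ∧ ∃ e : P.V ≃+ S.obj P.H, ∀ (a : A.obj (P.H.prod P.H)) (v : P.V),
    e (GreenBisetFunctor.toHat a • v) = S.act a (e v)

theorem corresponds_seed {S : GreenModule A} (hS : S.IsSimple) {H : BisetCat R Z}
    (hH : S.IsMinimal H) : S.Corresponds (seed hS hH) :=
  ⟨hH, AddEquiv.refl _, fun _ _ => rfl⟩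

theorem Corresponds.of_isIso {S T : GreenModule A} {P : A.Seed} (h : S.Corresponds P)
    (hST : S.IsIso T) : T.Corresponds P := by
  obtain ⟨⟨hH, hmin⟩, f, hf⟩ := h
  obtain ⟨e, he, he'⟩ := hST
  refine ⟨⟨(e P.H).symm.toEquiv.nontrivial, fun K hK => ?_⟩,
    f.trans (e P.H).toAddEquiv, fun a v => ?_⟩
  · have := hmin K hK
    exact (e K).symm.toEquiv.subsingleton
  · exact (congrArg (e P.H) (hf a v)).trans (IsIso.act e he he' a (f v))

theorem act_isoElt_symm_act (M : GreenModule A) {G H : BisetCat R Z} (φ : H ≃* G) (m : M.obj H) :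
    M.act (A.isoElt φ.symm) (M.act (A.isoElt φ) m) = m := by
  rw [← M.act_comp, A.isoElt_comp, MulEquiv.self_trans_symm, A.isoElt_refl, M.act_id]

/-- The isomorphism `M(H) ≅ M(G)` given by a group isomorphism `H ≅ G`. -/
noncomputable def isoEquiv (M : GreenModule A) {G H : BisetCat R Z} (φ : H ≃* G) :
    M.obj H ≃+ M.obj G where
  toFun := M.act (A.isoElt φ)
  invFun := M.act (A.isoElt φ.symm)
  left_inv := M.act_isoElt_symm_act φ
  right_inv := M.act_isoElt_symm_act φ.symm
  map_add' := map_add _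

theorem isoEquiv_act (M : GreenModule A) {G H : BisetCat R Z} (φ : H ≃* G)
    (a : A.obj (H.prod H)) (m : M.obj H) :
    M.isoEquiv φ (M.act a m) = M.act (A.conj φ a) (M.isoEquiv φ m) := by
  change M.act (A.isoElt φ) (M.act a m) = M.act (A.conj φ a) (M.act (A.isoElt φ) m)
  rw [GreenBisetFunctor.conj, M.act_comp, M.act_comp, M.act_isoElt_symm_act]

theorem IsMinimal.of_mulEquiv {M : GreenModule A} {G H : BisetCat R Z} (hH : M.IsMinimal H)
    (φ : H ≃* G) : M.IsMinimal G := by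
  have := hH.1
  exact ⟨(M.isoEquiv φ).symm.toEquiv.nontrivial,
    fun K hK => hH.2 K (Nat.card_congr φ.toEquiv ▸ hK)⟩

theorem Corresponds.of_equiv {S : GreenModule A} {P Q : A.Seed} (h : S.Corresponds P)
    (hPQ : P ≈ Q) : S.Corresponds Q := by
  obtain ⟨hH, f, hf⟩ := h
  obtain ⟨φ, e, he⟩ := Setoid.symm hPQ
  refine ⟨IsMinimal.of_mulEquiv hH φ.symm, (e.trans f).trans (S.isoEquiv φ).symm, fun a v => ?_⟩
  rw [AddEquiv.trans_apply, AddEquiv.symm_apply_eq, isoEquiv_act, AddEquiv.trans_apply, he, hf]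
  simp

/-- Couples corresponding to the same module are equivalent if their groups are isomorphic. -/
theorem Corresponds.equiv {S : GreenModule A} {P Q : A.Seed} (h : S.Corresponds P)
    (h' : S.Corresponds Q) (φ : P.H ≃* Q.H) : P ≈ Q := by
  obtain ⟨hH, f, hf⟩ := h
  obtain ⟨hG, g, hg⟩ := h'
  refine ⟨φ, (f.trans (S.isoEquiv φ)).trans g.symm, fun a v => ?_⟩
  rw [AddEquiv.trans_apply, AddEquiv.symm_apply_eq, hg, AddEquiv.trans_apply, hf, isoEquiv_act]
  simp

/-- Two simple modules `S` and `T` with `S(H) ≅ T(H) ≠ 0` are isomorphic: for `m ≠ 0` in `S(H)`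
with image `m'` in `T(H)`, the maps `α ↦ α m` and `α ↦ α m'` on `A(G × H)` are surjective with
the same kernel. -/
theorem IsSimple.isIso {S T : GreenModule A} (hS : S.IsSimple) (hT : T.IsSimple)
    {H : BisetCat R Z} (hH : Nontrivial (S.obj H)) (f : S.obj H ≃+ T.obj H)
    (hf : ∀ (a : A.obj (H.prod H)) (m : S.obj H), f (S.act a m) = T.act a (f m)) : S.IsIso T := by
  obtain ⟨m, hm⟩ := exists_ne (0 : S.obj H)
  have hm' : f m ≠ 0 := fun h => hm (f.injective (h.trans (map_zero f).symm))
  have hker : ∀ G : BisetCat R Z, LinearMap.ker (S.act.flip m : A.obj (G.prod H) →ₗ[R] S.obj G)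
      = LinearMap.ker (T.act.flip (f m) : A.obj (G.prod H) →ₗ[R] T.obj G) := by
    intro G
    ext a
    rw [LinearMap.mem_ker, LinearMap.mem_ker, LinearMap.flip_apply, LinearMap.flip_apply]
    constructor
    · refine fun h => hT.eq_zero_of_act (H := H) f.symm.toEquiv.nontrivial fun b => ?_
      rw [← T.act_comp, ← hf, S.act_comp, h, map_zero, map_zero]
    · refine fun h => hS.eq_zero_of_act (H := H) hH fun b => f.injective ?_
      rw [← S.act_comp, hf, T.act_comp, h, map_zero, map_zero]
  let e : ∀ G : BisetCat R Z, S.obj G ≃ₗ[R] T.obj G := fun G =>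
    ((S.act.flip m : A.obj (G.prod H) →ₗ[R] S.obj G).quotKerEquivOfSurjective
      (hS.exists_act_eq hm)).symm.trans ((Submodule.quotEquivOfEq _ _ (hker G)).trans
      ((T.act.flip (f m) : A.obj (G.prod H) →ₗ[R] T.obj G).quotKerEquivOfSurjective
      (hT.exists_act_eq hm')))
  have he : ∀ {G : BisetCat R Z} (a : A.obj (G.prod H)), e G (S.act a m) = T.act a (f m) := by
    intro G a
    have : ((S.act.flip m : A.obj (G.prod H) →ₗ[R] S.obj G).quotKerEquivOfSurjective
        (hS.exists_act_eq hm)).symm (S.act a m) = Submodule.Quotient.mk a :=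
      (LinearEquiv.symm_apply_eq _).2 rfl
    simp only [e, LinearEquiv.trans_apply]
    rw [this]
    rfl
  refine isIso_of_act e fun {G K} b x => ?_
  obtain ⟨a, rfl⟩ := hS.exists_act_eq hm x
  rw [← S.act_comp, he, he, T.act_comp]

/-! ### The simple module of a couple -/

theorem toHat_comp_smul (P : A.Seed) (a b : A.obj (P.H.prod P.H)) (v : P.V) :
    (GreenBisetFunctor.toHat (A.comp a b) : A.Hat P.H) • v
      = (GreenBisetFunctor.toHat a : A.Hat P.H) • (GreenBisetFunctor.toHat b : A.Hat P.H) • v :=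
  SemigroupAction.mul_smul (GreenBisetFunctor.toHat a : A.Hat P.H)
    (GreenBisetFunctor.toHat b : A.Hat P.H) v

/-- The additive map `a ↦ a v` from `A(H × H)` to `V`. -/
noncomputable def seedEval (P : A.Seed) (v : P.V) : A.obj (P.H.prod P.H) →+ P.V :=
  ((AddMonoidHom.flip (smulAddHom (A.Hat P.H) P.V)) v).comp
    (Ideal.Quotient.mk (A.ideal P.H)).toAddMonoidHom

theorem seedEval_apply (P : A.Seed) (v : P.V) (a : A.obj (P.H.prod P.H)) :
    seedEval P v a = (GreenBisetFunctor.toHat a : A.Hat P.H) • v := rfl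

theorem seedEval_surjective (P : A.Seed) {v : P.V} (hv : v ≠ 0) :
    Function.Surjective (seedEval P v) := by
  intro w
  have := P.simple
  obtain ⟨c, hc⟩ := IsSimpleModule.toSpanSingleton_surjective (A.Hat P.H) hv w
  obtain ⟨a, rfl⟩ := Ideal.Quotient.mk_surjective c
  exact ⟨a, hc⟩

theorem seedEval_comp (P : A.Seed) (v : P.V) (a b : A.obj (P.H.prod P.H)) :
    seedEval P v (A.comp a b) = (GreenBisetFunctor.toHat a : A.Hat P.H) • seedEval P v b :=
  toHat_comp_smul P a b v

/-- The submodule of `A(G × H)` of the `x` such that `(b ∘ x) v = 0` for all `b` in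
`A(H × G)`. -/
noncomputable def annihilatorAt (P : A.Seed) (v : P.V) (G : BisetCat R Z) :
    Submodule R (A.obj (G.prod P.H)) where
  carrier := {x | ∀ b : A.obj (P.H.prod G), seedEval P v (A.comp b x) = 0}
  zero_mem' b := by rw [map_zero, map_zero]
  add_mem' {x y} hx hy b := by rw [map_add, map_add, hx b, hy b, add_zero]
  smul_mem' c x hx b := by
    rw [_root_.map_smul, ← LinearMap.map_smul₂]
    exact hx (c • b)

theorem mem_annihilatorAt (P : A.Seed) (v : P.V) {G : BisetCat R Z} (x : A.obj (G.prod P.H)) :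
    x ∈ annihilatorAt P v G ↔ ∀ b : A.obj (P.H.prod G), seedEval P v (A.comp b x) = 0 :=
  Iff.rfl

theorem mem_annihilatorAt_self (P : A.Seed) (v : P.V) (x : A.obj (P.H.prod P.H)) :
    x ∈ annihilatorAt P v P.H ↔ seedEval P v x = 0 := by
  rw [mem_annihilatorAt]
  refine ⟨fun h => ?_, fun h b => ?_⟩
  · have := h (A.id P.H)
    rwa [A.id_comp] at this
  · rw [seedEval_comp, h, smul_zero]

/-- The `annihilatorAt P v G` as a submodule of the shift `G ↦ A(G × H)`. -/
noncomputable def annihilator (P : A.Seed) (v : P.V) : (shift A P.H).Sub :=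
  Sub.ofAct (shift A P.H) (annihilatorAt P v) (by
    intro G K a x hx b
    refine (congrArg (seedEval P v) ?_).trans (hx (A.comp b a))
    exact (congrArg (A.comp b) (shift_act a x)).trans (A.comp_assoc b a x).symm)

/-- The `A`-module associated with `(H, V)` and `v` in `V`: the quotient of `G ↦ A(G × H)` by
the `x` such that `(b ∘ x) v = 0` for all `b` in `A(H × G)`. -/
noncomputable def ofSeed (P : A.Seed) (v : P.V) : GreenModule A :=
  (shift A P.H).quot (annihilator P v)

/-- The class in `ofSeed P v` of an element of `A(G × H)`. -/
noncomputable def ofSeedMk (P : A.Seed) (v : P.V) (G : BisetCat R Z) :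
    A.obj (G.prod P.H) →ₗ[R] (ofSeed P v).obj G :=
  (shift A P.H).proj (annihilator P v) G

theorem ofSeedMk_surjective (P : A.Seed) (v : P.V) (G : BisetCat R Z) :
    Function.Surjective (ofSeedMk P v G) := (shift A P.H).proj_surjective _ G

theorem ofSeedMk_eq_zero (P : A.Seed) (v : P.V) {G : BisetCat R Z} {x : A.obj (G.prod P.H)} :
    ofSeedMk P v G x = 0 ↔ x ∈ annihilatorAt P v G := (shift A P.H).proj_eq_zero _

theorem act_ofSeedMk (P : A.Seed) (v : P.V) {G K : BisetCat R Z} (a : A.obj (K.prod G))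
    (x : A.obj (G.prod P.H)) :
    (ofSeed P v).act a (ofSeedMk P v G x) = ofSeedMk P v K (A.comp a x) :=
  congrArg (ofSeedMk P v K) (shift_act a x)

theorem ofSeed_isMinimal (P : A.Seed) {v : P.V} (hv : v ≠ 0) : (ofSeed P v).IsMinimal P.H := by
  refine ⟨⟨ofSeedMk P v P.H (A.id P.H), 0, fun h => hv ?_⟩, fun K hK => ?_⟩
  · rw [ofSeedMk_eq_zero, mem_annihilatorAt_self] at h
    exact (_root_.one_smul (A.Hat P.H) v).symm.trans h
  · refine subsingleton_of_forall_eq 0 fun y => ?_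
    obtain ⟨x, rfl⟩ := ofSeedMk_surjective P v K y
    refine (ofSeedMk_eq_zero P v).2 fun b => ?_
    have : (GreenBisetFunctor.toHat (A.comp b x) : A.Hat P.H) = 0 :=
      Ideal.Quotient.eq_zero_iff_mem.2 (Submodule.subset_span ⟨K, b, x, hK, rfl⟩)
    rw [seedEval_apply, this, zero_smul]

/-- If `N` is a submodule of `ofSeed P v`, the `a v` for `a` in the preimage of `N(H)` form a
submodule of the simple module `V`. If it is `V`, then `N(H)` contains the class of the identity,
which generates; if it is `0`, then `N = 0` by the definition of the quotient. -/
theorem ofSeed_isSimple (P : A.Seed) {v : P.V} (hv : v ≠ 0) : (ofSeed P v).IsSimple := by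
  refine ⟨⟨P.H, (ofSeed_isMinimal P hv).1⟩, fun N => ?_⟩
  let W : Submodule (A.Hat P.H) P.V :=
    { carrier := {w | ∃ a, ofSeedMk P v P.H a ∈ N.carrier P.H ∧ seedEval P v a = w}
      zero_mem' := ⟨0, by rw [map_zero]; exact zero_mem _, map_zero _⟩
      add_mem' := by
        rintro _ _ ⟨a, ha, rfl⟩ ⟨b, hb, rfl⟩
        exact ⟨a + b, by rw [map_add]; exact add_mem ha hb, map_add _ _ _⟩
      smul_mem' := by
        rintro c _ ⟨a, ha, rfl⟩
        obtain ⟨c, rfl⟩ := Ideal.Quotient.mk_surjective c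
        exact ⟨A.comp (H := P.H) (G := P.H) (K := P.H) c a, by
          exact act_ofSeedMk P v (G := P.H) (K := P.H) c a ▸ N.act_mem _ ha, seedEval_comp P v c a⟩ }
  have := P.simple
  rcases eq_bot_or_eq_top W with h | h
  · refine Or.inl fun G => (Submodule.eq_bot_iff _).2 fun y hy => ?_
    obtain ⟨x, rfl⟩ := ofSeedMk_surjective P v G y
    refine (ofSeedMk_eq_zero P v).2 fun b => ?_
    have hb : seedEval P v (A.comp b x) ∈ W :=
      ⟨A.comp b x, by rw [← act_ofSeedMk]; exact N.act_mem b hy, rfl⟩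
    rw [h] at hb
    exact (Submodule.mem_bot _).1 hb
  · refine Or.inr fun G => Submodule.eq_top_iff'.2 fun y => ?_
    obtain ⟨x, rfl⟩ := ofSeedMk_surjective P v G y
    obtain ⟨a, ha, hav⟩ : v ∈ W := h ▸ Submodule.mem_top
    have hid : seedEval P v (A.id P.H) = v := _root_.one_smul (A.Hat P.H) v
    have e : ofSeedMk P v P.H a = ofSeedMk P v P.H (A.id P.H) := by
      rw [← sub_eq_zero, ← map_sub, ofSeedMk_eq_zero, mem_annihilatorAt_self, map_sub, hav, hid,
        sub_self]
    have := N.act_mem x (e ▸ ha)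
    rwa [act_ofSeedMk, A.comp_id] at this

theorem corresponds_ofSeed (P : A.Seed) {v : P.V} (hv : v ≠ 0) :
    (ofSeed P v).Corresponds P := by
  have hker : (seedEval P v).ker = (ofSeedMk P v P.H).toAddMonoidHom.ker := by
    ext x
    exact (mem_annihilatorAt_self P v x).symm.trans (ofSeedMk_eq_zero P v).symm
  let e : P.V ≃+ (ofSeed P v).obj P.H :=
    (QuotientAddGroup.quotientKerEquivOfSurjective (seedEval P v)
      (seedEval_surjective P hv)).symm.trans
    ((QuotientAddGroup.quotientAddEquivOfEq hker).trans
    (QuotientAddGroup.quotientKerEquivOfSurjective (ofSeedMk P v P.H).toAddMonoidHom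
      (ofSeedMk_surjective P v P.H)))
  have he : ∀ a, e (seedEval P v a) = ofSeedMk P v P.H a := by
    intro a
    have : (QuotientAddGroup.quotientKerEquivOfSurjective (seedEval P v)
        (seedEval_surjective P hv)).symm (seedEval P v a) = QuotientAddGroup.mk a :=
      (AddEquiv.symm_apply_eq _).2 rfl
    simp only [e, AddEquiv.trans_apply]
    rw [this]
    rfl
  refine ⟨ofSeed_isMinimal P hv, e, fun a w => ?_⟩
  obtain ⟨b, rfl⟩ := seedEval_surjective P hv w
  rw [← seedEval_comp, he, he, act_ofSeedMk]

theorem exists_corresponds (P : A.Seed) :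
    ∃ S : GreenModule A, S.IsSimple ∧ S.Corresponds P := by
  have := P.simple
  have := IsSimpleModule.nontrivial (A.Hat P.H) P.V
  obtain ⟨v, hv⟩ := exists_ne (0 : P.V)
  exact ⟨ofSeed P v, ofSeed_isSimple P hv, corresponds_ofSeed P hv⟩

theorem Corresponds.isIso {S T : GreenModule A} {P : A.Seed} (hS : S.IsSimple) (hT : T.IsSimple)
    (h : S.Corresponds P) (h' : T.Corresponds P) : S.IsIso T := by
  obtain ⟨hH, f, hf⟩ := h
  obtain ⟨-, g, hg⟩ := h'
  refine hS.isIso hT hH.1 (f.symm.trans g) fun a m => ?_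
  obtain ⟨v, rfl⟩ := f.surjective m
  rw [← hf]
  simp only [AddEquiv.trans_apply, AddEquiv.symm_apply_apply, hg]

end GreenModule

/-! ### The bijection -/

theorem proposition4p2 {R : Type r} [CommRing R] {Z : GroupClass.{u}}
    (A : GreenBisetFunctor.{u, r, w} R Z)
    (hA : ∀ S : GreenModule A, S.IsSimple → ∀ G H : BisetCat R Z,
      S.IsMinimal G → S.IsMinimal H → Nonempty (G ≃* H)) :
    ∃ Φ : GreenModule.SimpleClass A ≃ A.SeedClass,
      ∀ (S : {S : GreenModule A // S.IsSimple}) (P : A.Seed),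
        Φ (Quotient.mk (GreenModule.simpleSetoid A) S) = Quotient.mk A.seedSetoid P ↔
          S.1.IsMinimal P.H ∧ ∃ e : P.V ≃+ S.1.obj P.H,
            ∀ (a : A.obj (P.H.prod P.H)) (v : P.V),
              e (GreenBisetFunctor.toHat a • v) = S.1.act a (e v) := by
  choose H hH using fun S : {S : GreenModule A // S.IsSimple} => S.2.exists_isMinimal
  let Ψ : {S : GreenModule A // S.IsSimple} → A.Seed := fun S => GreenModule.seed S.2 (hH S)
  have hΨ : ∀ S : {S : GreenModule A // S.IsSimple}, S.1.Corresponds (Ψ S) := fun S =>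
    GreenModule.corresponds_seed S.2 (hH S)
  have uniq : ∀ (S : {S : GreenModule A // S.IsSimple}) {P Q : A.Seed},
      S.1.Corresponds P → S.1.Corresponds Q → P ≈ Q := fun S P Q hP hQ =>
    hP.equiv hQ (hA S.1 S.2 _ _ hP.1 hQ.1).some
  let F : GreenModule.SimpleClass A → A.SeedClass :=
    Quotient.map Ψ fun S T hST => uniq T ((hΨ S).of_isIso hST) (hΨ T)
  have hF : Function.Bijective F := by
    constructor
    · rintro ⟨S⟩ ⟨T⟩ h
      exact Quotient.sound
        (GreenModule.Corresponds.isIso S.2 T.2 ((hΨ S).of_equiv (Quotient.exact h)) (hΨ T))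
    · rintro ⟨P⟩
      obtain ⟨S, hS, hSP⟩ := GreenModule.exists_corresponds P
      exact ⟨Quotient.mk _ ⟨S, hS⟩, Quotient.sound (uniq ⟨S, hS⟩ (hΨ ⟨S, hS⟩) hSP)⟩
  refine ⟨Equiv.ofBijective F hF, fun S P => ⟨fun h => ?_, fun h => ?_⟩⟩
  · exact (hΨ S).of_equiv (Quotient.exact h)
  · exact Quotient.sound (uniq S (hΨ S) h)
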